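/- Let $d\ge 1$, $2\le p<\infty$, and let $\mathcal O\subset\mathbb R^d$ be a bounded domain with boundary of class $C^2$. Let $\mathcal M=\{f\in L^2(\mathcal O):\|f\|_{L^2(\mathcal O)}=1\}$, let $A=-\Delta$ be the Dirichlet Laplacian in $L^2(\mathcal O)$ with domain $D(A)=\{f\in H^1_0(\mathcal O):\Delta f\in L^2(\mathcal O)\}$, and put $$\mathcal S(f)=\|\nabla f\|_{L^2(\mathcal O)}^2+\|f\|_{L^p(\mathcal O)}^p,\qquad \mathscr G(f)=\Delta f-|f|^{p-2}f+\mathcal S(f)f .$$ The space $L^p(\mathcal O)\cap H^1_0(\mathcal O)$ carries the norm $\max\{\|f\|_{L^p(\mathcal O)},\|\nabla f\|_{L^2(\mathcal O)}\}$. For $u_0\in L^p(\mathcal O)\cap H^1_0(\mathcal O)\cap\mathcal M$ and $T>0$, a strong solution on $[0,T]$ of $$\partial_t u=\Delta u-|u|^{p-2}u+\mathcal S(u)u,\qquad u(0)=u_0,\qquad u|_{\partial\mathcal O}=0,\tag{1}$$ is a function $$u\in C([0,T];L^p(\mathcal O)\cap H_0^1(\mathcal O)\cap\mathcal M)\cap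 L^2(0,T;D(A))\cap L^{2p-2}(0,T;L^{2p-2}(\mathcal O))$$ such that the weak time derivative $\partial_t u$ and $\mathscr G(u)$ belong to $L^2(0,T;L^2(\mathcal O))$, $\int_0^T(\partial_t u(t)-\mathscr G(u(t)),\varphi(t))_{L^2(\mathcal O)}\,dt=0$ for all $\varphi\in L^2(0,T;L^2(\mathcal O))$, and $u(0)=u_0$. **Proposition.** Let $u_0\in L^p(\mathcal O)\cap H^1_0(\mathcal O)\cap\mathcal M$, and let $u$, defined on $[0,\infty)$, be a strong solution of (1) on $[0,T]$ for every $T>0$, such that $\partial_t u\in L^2(0,\infty;L^2(\mathcal O))$. Then there are times $\tau_n\ge 0$ with $\tau_n\to\infty$ and a function $u_\infty\in L^p(\mathcal O)\cap H^1_0(\mathcal O)\cap\mathcal M$ such that, as $n\to\infty$, $$u(\tau_n)\to u_\infty\ \text{ strongly in } L^p(\mathcal O)\cap H^1_0(\mathcal O),\qquad \mathcal S(u(\tau_n))\to\mathcal S(u_\infty),$$ and $u_\infty$ solves $$\Delta u_\infty-|u_\infty|^{p-2}u_\infty+\mathcal S(u_\infty)u_\infty=0\quad\text{in } L^{\frac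 p{p-1}}(\mathcal O)+H^{-1}(\mathcal O),$$ that is, $-\int_{\mathcal O}\nabla u_\infty\cdot\nabla\psi\,dx-\int_{\mathcal O}|u_\infty|^{p-2}u_\infty\psi\,dx+\mathcal S(u_\infty)\int_{\mathcal O}u_\infty\psi\,dx=0$ for all $\psi\in L^p(\mathcal O)\cap H^1_0(\mathcal O)$. -/

import Mathlib

open MeasureTheory Set Filter Topology
open scoped ContDiff ENNReal

noncomputable section

namespace ConstrainedHeat

/-- The Euclidean space `ℝ^d`. -/
abbrev Rd (d : ℕ) : Type := EuclideanSpace ℝ (Fin d)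

variable {d : ℕ}

/-- Lebesgue measure on `O`. -/
abbrev leb (O : Set (Rd d)) : Measure (Rd d) := volume.restrict O

/-- The real Hilbert space `L²(O)`. -/
abbrev L2 (O : Set (Rd d)) : Type := Lp ℝ 2 (leb O)

/-- The Hilbert space `L²(O; ℝ^d)` of square integrable vector fields. -/
abbrev L2Vec (O : Set (Rd d)) : Type := Lp (Rd d) 2 (leb O)

/-- The boundary of the open set `O` is of class `C²`: near every boundary point, `O` is the set
where a `C²` function with non-vanishing differential at that point is negative. -/
def HasC2Boundary (O : Set (Rd d)) : Prop :=
  ∀ x ∈ frontier O, ∃ (U : Set (Rd d)) (ρ : Rd d → ℝ), IsOpen U ∧ x ∈ U ∧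
    ContDiffOn ℝ 2 ρ U ∧ fderiv ℝ ρ x ≠ 0 ∧ O ∩ U = {y ∈ U | ρ y < 0}

/-- Test functions: smooth functions whose support is a compact subset of `O`. -/
def IsTest (O : Set (Rd d)) (φ : Rd d → ℝ) : Prop :=
  ContDiff ℝ ∞ φ ∧ HasCompactSupport φ ∧ tsupport φ ⊆ O

lemma gradient_add_fun {φ ψ : Rd d → ℝ} (hφ : ContDiff ℝ ∞ φ) (hψ : ContDiff ℝ ∞ ψ) :
    gradient (φ + ψ) = gradient φ + gradient ψ := by
  funext x
  have h1 := (hφ.differentiable (by simp)) x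
  have h2 := (hψ.differentiable (by simp)) x
  simp [gradient, fderiv_add h1 h2]

lemma gradient_smul_fun {φ : Rd d → ℝ} (hφ : ContDiff ℝ ∞ φ) (c : ℝ) :
    gradient (c • φ) = c • gradient φ := by
  funext x
  have h1 := (hφ.differentiable (by simp)) x
  simp [gradient, fderiv_const_smul h1 c]

lemma isTest_zero (O : Set (Rd d)) : IsTest O (0 : Rd d → ℝ) := by
  refine ⟨contDiff_const, HasCompactSupport.zero, ?_⟩
  simp [tsupport]

lemma IsTest.add {O : Set (Rd d)} {φ ψ : Rd d → ℝ} (hφ : IsTest O φ) (hψ : IsTest O ψ) :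
    IsTest O (φ + ψ) :=
  ⟨hφ.1.add hψ.1, hφ.2.1.add hψ.2.1,
    (tsupport_add φ ψ).trans (union_subset hφ.2.2 hψ.2.2)⟩

lemma IsTest.smul {O : Set (Rd d)} {φ : Rd d → ℝ} (hφ : IsTest O φ) (c : ℝ) :
    IsTest O (c • φ) := by
  refine ⟨contDiff_const.smul hφ.1, ?_, ?_⟩
  · exact HasCompactSupport.smul_left (f := fun _ => c) hφ.2.1
  · exact (tsupport_smul_subset_right (fun _ => c) φ).trans hφ.2.2

/-- The pairs `(φ, ∇φ)` with `φ` a test function, in `L²(O) × L²(O; ℝ^d)`. -/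
def testGraph (O : Set (Rd d)) : Submodule ℝ (L2 O × L2Vec O) where
  carrier := {w | ∃ φ : Rd d → ℝ, IsTest O φ ∧
    (w.1 : Rd d → ℝ) =ᵐ[leb O] φ ∧ (w.2 : Rd d → Rd d) =ᵐ[leb O] gradient φ}
  zero_mem' := by
    refine ⟨0, isTest_zero O, Lp.coeFn_zero _ _ _, ?_⟩
    have : gradient (0 : Rd d → ℝ) = 0 := by
      funext x
      simp [gradient]
    rw [this]
    exact Lp.coeFn_zero _ _ _
  add_mem' := by
    rintro a b ⟨φ, hφ, h1, h2⟩ ⟨ψ, hψ, h3, h4⟩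
    refine ⟨φ + ψ, hφ.add hψ, (Lp.coeFn_add _ _).trans (h1.add h3), ?_⟩
    rw [gradient_add_fun hφ.1 hψ.1]
    exact (Lp.coeFn_add _ _).trans (h2.add h4)
  smul_mem' := by
    rintro c a ⟨φ, hφ, h1, h2⟩
    refine ⟨c • φ, hφ.smul c, (Lp.coeFn_smul _ _).trans (h1.const_smul c), ?_⟩
    rw [gradient_smul_fun hφ.1 c]
    exact (Lp.coeFn_smul _ _).trans (h2.const_smul c)

/-- The pairs `(f, ∇f)` with `f ∈ H¹₀(O)`: the closure of the pairs `(φ, ∇φ)`, `φ` a test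
function, in `L²(O) × L²(O; ℝ^d)`. -/
def H01Graph (O : Set (Rd d)) : Submodule ℝ (L2 O × L2Vec O) :=
  (testGraph O).topologicalClosure

/-- The Sobolev space `H¹₀(O)`, the closure of the test functions in `H¹(O)`. -/
def H01 (O : Set (Rd d)) : Submodule ℝ (L2 O) :=
  (H01Graph O).map (LinearMap.fst ℝ (L2 O) (L2Vec O))

lemma mem_H01_iff {O : Set (Rd d)} {f : L2 O} : f ∈ H01 O ↔ ∃ g, (f, g) ∈ H01Graph O := by
  simp [H01]

open Classical in
/-- The weak gradient of `f ∈ H¹₀(O)` (and `0` for other `f`). It is unique, see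
`H01Graph_unique`. -/
def wgrad {O : Set (Rd d)} (f : L2 O) : L2Vec O :=
  if h : ∃ g, (f, g) ∈ H01Graph O then h.choose else 0

lemma IsTest.memLp {O : Set (Rd d)} {φ : Rd d → ℝ} (hφ : IsTest O φ) : MemLp φ 2 (leb O) :=
  (hφ.1.continuous.memLp_of_hasCompactSupport hφ.2.1).restrict O

lemma IsTest.memLp_fderiv {O : Set (Rd d)} {φ : Rd d → ℝ} (hφ : IsTest O φ) (v : Rd d) :
    MemLp (fun x => fderiv ℝ φ x v) 2 (leb O) := by
  have h1 : Continuous (fun x => fderiv ℝ φ x v) :=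
    (hφ.1.continuous_fderiv (by simp)).clm_apply continuous_const
  have h2 : HasCompactSupport (fun x => fderiv ℝ φ x v) := hφ.2.1.fderiv_apply ℝ v
  exact (h1.memLp_of_hasCompactSupport h2).restrict O

lemma continuous_integral_mul {O : Set (Rd d)} {c : Rd d → ℝ} (hc : MemLp c 2 (leb O)) :
    Continuous (fun f : L2 O => ∫ x in O, f x * c x) := by
  have h : (fun f : L2 O => ∫ x in O, f x * c x) = fun f : L2 O => inner ℝ (hc.toLp c) f := by
    funext f
    rw [L2.inner_def]
    refine integral_congr_ae ?_
    filter_upwards [hc.coeFn_toLp] with x hx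
    simp [hx]
  rw [h]
  exact continuous_const.inner continuous_id

lemma continuous_integral_inner {O : Set (Rd d)} {c : Rd d → ℝ} (hc : MemLp c 2 (leb O)) (v : Rd d) :
    Continuous (fun g : L2Vec O => ∫ x in O, inner ℝ (g x) v * c x) := by
  have hcv : MemLp (fun x => c x • v) 2 (leb O) := by
    exact (ContinuousLinearMap.toSpanSingleton ℝ v).comp_memLp' hc
  have h : (fun g : L2Vec O => ∫ x in O, inner ℝ (g x) v * c x) =
      fun g : L2Vec O => inner ℝ (hcv.toLp _) g := by
    funext g
    rw [L2.inner_def]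
    refine integral_congr_ae ?_
    filter_upwards [hcv.coeFn_toLp] with x hx
    rw [hx, real_inner_smul_left, real_inner_comm, mul_comm]
  rw [h]
  exact continuous_const.inner continuous_id

lemma IsTest.integral_by_parts {O : Set (Rd d)} {φ ψ : Rd d → ℝ} (hφ : IsTest O φ)
    (hψ : IsTest O ψ) (v : Rd d) :
    ∫ x in O, φ x * fderiv ℝ ψ x v = - ∫ x in O, inner ℝ (gradient φ x) v * ψ x := by
  have e1 : ∫ x in O, φ x * fderiv ℝ ψ x v = ∫ x, φ x * fderiv ℝ ψ x v := by
    refine setIntegral_eq_integral_of_forall_compl_eq_zero fun x hx => ?_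
    rw [image_eq_zero_of_notMem_tsupport (fun h => hx (hφ.2.2 h)), zero_mul]
  have e2 : ∫ x in O, inner ℝ (gradient φ x) v * ψ x = ∫ x, fderiv ℝ φ x v * ψ x := by
    rw [setIntegral_eq_integral_of_forall_compl_eq_zero]
    · simp [gradient]
    · intro x hx
      rw [image_eq_zero_of_notMem_tsupport (fun h => hx (hψ.2.2 h)), mul_zero]
  have c1 : Continuous (fun x => fderiv ℝ φ x v) :=
    (hφ.1.continuous_fderiv (by simp)).clm_apply continuous_const
  have c2 : Continuous (fun x => fderiv ℝ ψ x v) :=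
    (hψ.1.continuous_fderiv (by simp)).clm_apply continuous_const
  rw [e1, e2]
  refine integral_mul_fderiv_eq_neg_fderiv_mul_of_integrable ?_ ?_ ?_ ?_ ?_
  · exact (c1.mul hψ.1.continuous).integrable_of_hasCompactSupport hψ.2.1.mul_left
  · exact (hφ.1.continuous.mul c2).integrable_of_hasCompactSupport hφ.2.1.mul_right
  · exact (hφ.1.continuous.mul hψ.1.continuous).integrable_of_hasCompactSupport hφ.2.1.mul_right
  · exact fun x _ => (hφ.1.differentiable (by simp)) x
  · exact fun x _ => (hψ.1.differentiable (by simp)) x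

/-- `∇f` is the weak gradient of `f`: integration by parts against test functions. -/
lemma H01Graph_weak {O : Set (Rd d)} {w : L2 O × L2Vec O} (hw : w ∈ H01Graph O)
    {ψ : Rd d → ℝ} (hψ : IsTest O ψ) (v : Rd d) :
    ∫ x in O, w.1 x * fderiv ℝ ψ x v = - ∫ x in O, inner ℝ (w.2 x) v * ψ x := by
  have hclosed : IsClosed {w : L2 O × L2Vec O |
      ∫ x in O, w.1 x * fderiv ℝ ψ x v = - ∫ x in O, inner ℝ (w.2 x) v * ψ x} :=
    isClosed_eq ((continuous_integral_mul (hψ.memLp_fderiv v)).comp continuous_fst)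
      ((continuous_integral_inner hψ.memLp v).comp continuous_snd).neg
  have hsub : (testGraph O : Set (L2 O × L2Vec O)) ⊆ {w : L2 O × L2Vec O |
      ∫ x in O, w.1 x * fderiv ℝ ψ x v = - ∫ x in O, inner ℝ (w.2 x) v * ψ x} := by
    rintro a ⟨φ, hφ, h1, h2⟩
    have i1 : ∫ x in O, a.1 x * fderiv ℝ ψ x v = ∫ x in O, φ x * fderiv ℝ ψ x v := by
      refine integral_congr_ae ?_
      filter_upwards [h1] with x hx
      rw [hx]
    have i2 : ∫ x in O, inner ℝ (a.2 x) v * ψ x = ∫ x in O, inner ℝ (gradient φ x) v * ψ x := by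
      refine integral_congr_ae ?_
      filter_upwards [h2] with x hx
      rw [hx]
    change _ = _
    rw [i1, i2]
    exact hφ.integral_by_parts hψ v
  exact closure_minimal hsub hclosed hw

lemma ae_zero_of_test {O : Set (Rd d)} (hO : IsOpen O) {f : Rd d → ℝ} (hf : MemLp f 2 (leb O))
    (h : ∀ ψ, IsTest O ψ → ∫ x in O, f x * ψ x = 0) : f =ᵐ[leb O] 0 := by
  have hloc : LocallyIntegrableOn f O volume := by
    rw [locallyIntegrableOn_iff hO.isLocallyClosed]
    intro K hK hKc
    have h1 : MemLp f 2 (volume.restrict K) := by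
      have := hf.restrict K
      rwa [Measure.restrict_restrict hKc.measurableSet, inter_eq_self_of_subset_left hK] at this
    have : IsFiniteMeasure (volume.restrict K) := ⟨by simpa using hKc.measure_lt_top⟩
    exact h1.integrable (by norm_num)
  have key := hO.ae_eq_zero_of_integral_contDiff_smul_eq_zero hloc (fun ψ h1 h2 h3 => by
    have := h ψ ⟨h1, h2, h3⟩
    rw [setIntegral_eq_integral_of_forall_compl_eq_zero] at this
    · rw [← this]
      simp [mul_comm]
    · intro x hx
      rw [image_eq_zero_of_notMem_tsupport (fun hh => hx (h3 hh)), mul_zero])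
  exact (ae_restrict_iff' hO.measurableSet).2 key

lemma H01Graph_unique {O : Set (Rd d)} (hO : IsOpen O) {f : L2 O} {g g' : L2Vec O}
    (h : (f, g) ∈ H01Graph O) (h' : (f, g') ∈ H01Graph O) : g = g' := by
  have h0 : ((0 : L2 O), g - g') ∈ H01Graph O := by
    simpa using (H01Graph O).sub_mem h h'
  have hv : ∀ v : Rd d, (fun x => (inner ℝ ((g - g' : L2Vec O) x) v : ℝ)) =ᵐ[leb O] 0 := by
    intro v
    refine ae_zero_of_test hO ((Lp.memLp (g - g')).inner_const v) (fun ψ hψ => ?_)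
    have := H01Graph_weak h0 hψ v
    have z : ∫ x in O, (0 : L2 O) x * fderiv ℝ ψ x v = 0 := by
      rw [← integral_zero (Rd d) ℝ (μ := leb O)]
      refine integral_congr_ae ?_
      filter_upwards [Lp.coeFn_zero ℝ 2 (leb O)] with x hx
      rw [hx, Pi.zero_apply, zero_mul]
    simp only [z] at this
    linarith
  have hall : ∀ᵐ x ∂(leb O), ∀ i : Fin d,
      (inner ℝ ((g - g' : L2Vec O) x) (EuclideanSpace.single i (1 : ℝ)) : ℝ) = 0 :=
    ae_all_iff.2 fun i => hv _
  rw [← sub_eq_zero]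
  refine (Lp.eq_zero_iff_ae_eq_zero).2 ?_
  filter_upwards [hall] with x hx
  ext i
  simpa [EuclideanSpace.inner_single_right] using hx i

lemma wgrad_eq {O : Set (Rd d)} (hO : IsOpen O) {f : L2 O} {g : L2Vec O}
    (h : (f, g) ∈ H01Graph O) : wgrad f = g := by
  have hex : ∃ g, (f, g) ∈ H01Graph O := ⟨g, h⟩
  rw [wgrad, dif_pos hex]
  exact H01Graph_unique hO hex.choose_spec h

/-- `Δf = h` for `f ∈ H¹₀(O)`, `h ∈ L²(O)`: `-(∇f, ∇v) = (h, v)` for all `v ∈ H¹₀(O)`. -/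
def HasLaplacian {O : Set (Rd d)} (f h : L2 O) : Prop :=
  f ∈ H01 O ∧ ∀ v ∈ H01 O, - inner ℝ (wgrad f) (wgrad v) = inner ℝ h v

/-- The domain `D(A)` of the Dirichlet Laplacian `A = -Δ` in `L²(O)`. -/
def DomA (O : Set (Rd d)) : Set (L2 O) := {f | ∃ h, HasLaplacian f h}

open Classical in
/-- The Dirichlet Laplacian `Δf ∈ L²(O)` of `f ∈ D(A)` (and `0` for other `f`). It is unique, see
`HasLaplacian_unique`. -/
def lap {O : Set (Rd d)} (f : L2 O) : L2 O :=
  if h : ∃ h, HasLaplacian f h then h.choose else 0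

lemma IsTest.toLp_mem_H01 {O : Set (Rd d)} {φ : Rd d → ℝ} (hφ : IsTest O φ) :
    hφ.memLp.toLp φ ∈ H01 O := by
  have hg : MemLp (gradient φ) 2 (leb O) := by
    have h1 : Continuous (gradient φ) :=
      (InnerProductSpace.toDual ℝ (Rd d)).symm.continuous.comp (hφ.1.continuous_fderiv (by simp))
    have h2 : HasCompactSupport (gradient φ) :=
      (hφ.2.1.fderiv ℝ).comp_left (map_zero (InnerProductSpace.toDual ℝ (Rd d)).symm)
    exact (h1.memLp_of_hasCompactSupport h2).restrict O
  refine mem_H01_iff.2 ⟨hg.toLp _, (testGraph O).le_topologicalClosure ?_⟩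
  exact ⟨φ, hφ, hφ.memLp.coeFn_toLp, hg.coeFn_toLp⟩

lemma HasLaplacian_unique {O : Set (Rd d)} (hO : IsOpen O) {f h h' : L2 O}
    (H : HasLaplacian f h) (H' : HasLaplacian f h') : h = h' := by
  rw [← sub_eq_zero]
  refine (Lp.eq_zero_iff_ae_eq_zero).2 ?_
  refine ae_zero_of_test hO (Lp.memLp (h - h')) (fun ψ hψ => ?_)
  have e : (inner ℝ (h - h') (hψ.memLp.toLp ψ) : ℝ) = 0 := by
    rw [inner_sub_left, ← H.2 _ hψ.toLp_mem_H01, ← H'.2 _ hψ.toLp_mem_H01, sub_self]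
  rw [← e, L2.inner_def]
  refine integral_congr_ae ?_
  filter_upwards [hψ.memLp.coeFn_toLp] with x hx
  simp [hx, mul_comm]

lemma lap_eq {O : Set (Rd d)} (hO : IsOpen O) {f h : L2 O} (H : HasLaplacian f h) :
    lap f = h := by
  have hex : ∃ h, HasLaplacian f h := ⟨h, H⟩
  rw [lap, dif_pos hex]
  exact HasLaplacian_unique hO hex.choose_spec H

/-- `f ∈ L^p(O) ∩ H¹₀(O)` (for `p ≥ 2` and bounded `O`, so that `L^p(O) ⊆ L²(O)`). -/
def MemV {O : Set (Rd d)} (p : ℝ) (f : L2 O) : Prop :=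
  f ∈ H01 O ∧ MemLp f (ENNReal.ofReal p) (leb O)

/-- The norm `max {‖f‖_{L^p}, ‖∇f‖_{L²}}` of `f ∈ L^p(O) ∩ H¹₀(O)`. -/
def normV {O : Set (Rd d)} (p : ℝ) (f : L2 O) : ℝ≥0∞ :=
  max (eLpNorm f (ENNReal.ofReal p) (leb O)) (eLpNorm (wgrad f) 2 (leb O))

/-- The unit sphere `M` of `L²(O)`. -/
def unitSphere (O : Set (Rd d)) : Set (L2 O) := {f | ‖f‖ = 1}

/-- `S(f) = ‖∇f‖²_{L²} + ‖f‖^p_{L^p}`, for `f ∈ L^p(O) ∩ H¹₀(O)`. -/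
def S {O : Set (Rd d)} (p : ℝ) (f : L2 O) : ℝ :=
  ‖wgrad f‖ ^ 2 + ∫ x in O, |f x| ^ p

/-- The function `|f|^{p-2} f`. -/
def powFun {O : Set (Rd d)} (p : ℝ) (f : L2 O) : Rd d → ℝ := fun x => |f x| ^ (p - 2) * f x

open Classical in
/-- `|f|^{p-2} f` as an element of `L²(O)`, when it is square integrable (and `0` otherwise). -/
def powL2 {O : Set (Rd d)} (p : ℝ) (f : L2 O) : L2 O :=
  if h : MemLp (powFun p f) 2 (leb O) then h.toLp _ else 0

/-- `G(f) = Δf - |f|^{p-2} f + S(f) f`, for `f ∈ D(A) ∩ L^{2p-2}(O)`. -/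
def G {O : Set (Rd d)} (p : ℝ) (f : L2 O) : L2 O := lap f - powL2 p f + S p f • f

/-- `v` is the weak (distributional) derivative of `u` on the open time interval `I`. -/
def HasWeakTimeDeriv {O : Set (Rd d)} (I : Set ℝ) (u v : ℝ → L2 O) : Prop :=
  ∀ η : ℝ → ℝ, ContDiff ℝ ∞ η → HasCompactSupport η → tsupport η ⊆ I →
    ∫ t in I, deriv η t • u t = - ∫ t in I, η t • v t

/-- `u` is a strong solution on `[0, T]` of
`∂u/∂t = Δu - |u|^{p-2} u + S(u) u`, `u = 0` on `∂O`, `u(0) = u₀`. -/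
structure IsStrongSolution (O : Set (Rd d)) (p T : ℝ) (u₀ : L2 O) (u : ℝ → L2 O) : Prop where
  /-- `u` takes values in `L^p(O) ∩ H¹₀(O) ∩ M` -/
  mem : ∀ t ∈ Icc 0 T, MemV p (u t) ∧ u t ∈ unitSphere O
  /-- and is continuous on `[0, T]` with values in `L^p(O) ∩ H¹₀(O)`; -/
  cont : ∀ s ∈ Icc 0 T, Tendsto (fun t => normV p (u t - u s)) (𝓝[Icc 0 T] s) (𝓝 0)
  /-- `u ∈ L²(0, T; D(A))`; -/
  mem_domA : ∀ᵐ t ∂(volume.restrict (Ioo 0 T)), u t ∈ DomA O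
  memLp_lap : MemLp (fun t => lap (u t)) 2 (volume.restrict (Ioo 0 T))
  /-- `u ∈ L^{2p-2}(0, T; L^{2p-2}(O))`; -/
  memLp_pow : ∫⁻ t in Ioo 0 T, eLpNorm (u t) (ENNReal.ofReal (2 * p - 2)) (leb O) ^ (2 * p - 2) < (⊤ : ℝ≥0∞)
  /-- `G(u) ∈ L²(0, T; L²(O))`; -/
  memLp_G : MemLp (fun t => G p (u t)) 2 (volume.restrict (Ioo 0 T))
  /-- `∂u/∂t ∈ L²(0, T; L²(O))` and `∫₀ᵀ (∂u/∂t - G(u), φ) dt = 0` for `φ ∈ L²(0, T; L²(O))`; -/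
  eqn : ∃ v : ℝ → L2 O, HasWeakTimeDeriv (Ioo 0 T) u v ∧
    MemLp v 2 (volume.restrict (Ioo 0 T)) ∧
    ∀ φ : ℝ → L2 O, MemLp φ 2 (volume.restrict (Ioo 0 T)) →
      ∫ t in Ioo 0 T, (inner ℝ (v t - G p (u t)) (φ t) : ℝ) = 0
  /-- the initial condition. -/
  init : u 0 = u₀

/-- `Δf - |f|^{p-2} f + S(f) f = 0` in `L^{p/(p-1)}(O) + H⁻¹(O)`, for `f ∈ L^p(O) ∩ H¹₀(O)`.
Here `Δf ∈ H⁻¹(O)` is the functional `ψ ↦ -(∇f, ∇ψ)`, the function `|f|^{p-2} f` is in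
`L^{p/(p-1)}(O)`, and an element of the sum space is zero when its natural pairing with every
`ψ ∈ L^p(O) ∩ H¹₀(O)` is zero. -/
def SolvesStationary {O : Set (Rd d)} (p : ℝ) (f : L2 O) : Prop :=
  MemV p f ∧ MemLp (powFun p f) (ENNReal.ofReal (p / (p - 1))) (leb O) ∧
    ∀ ψ : L2 O, MemV p ψ →
      - inner ℝ (wgrad f) (wgrad ψ) - (∫ x in O, powFun p f x * ψ x) + S p f * inner ℝ f ψ = 0

end ConstrainedHeat

end

open ConstrainedHeat

/-!
The equation is the gradient flow of the energy `E(f) = ½‖∇f‖² + (1/p)‖f‖_p^p`, constrained to the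
unit sphere of `L²(O)`. Since `E` is convex, with subgradient `|f|^{p-2} f - Δf = S(f) f - G(f)`,
the whole argument runs on the subgradient inequality
`E(f) - E(g) ≤ (S(f) f - G(f), f - g)` (`energy_sub_energy_le`); neither a chain rule for the
energy along the flow nor weak convergence is used.

*Bounded energy.* At almost every time `G(u(t)) = ∂ₜu(t)` (`ae_isRegular_and_G_eq`), and for `f`,
`g` on the sphere `(f, f - g) = ½‖f - g‖²`. With `‖u(t) - u(s)‖² ≤ (t - s) ∫ₛᵗ ‖∂ₜu‖²`
(`norm_sub_sq_le_integral`), the subgradient inequality between suitable times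
`τ_n ∈ (n, n + 1]` reads
`E(u(τ_{n+1})) (1 - p b_n) ≤ E(u(τ_n)) + 2 b_n`, where `b_n = ∫_n^{n+2} ‖∂ₜu‖²` is summable. A
discrete Grönwall lemma bounds the energy along these times, and `G(u(τ_n)) → 0` (`exists_times`).

*Convergence.* By Rellich's theorem (`exists_tendsto_subseq_of_bounded`) a subsequence converges in
`L²(O)`. The subgradient is strongly monotone, so that differences in `H¹₀(O)` and `L^p(O)` are
controlled by differences in `L²(O)` (`norm_wgrad_sub_add_le_mul_norm`), and the subsequence is
Cauchy in `L^p(O) ∩ H¹₀(O)` (`tendsto_normV_of_tendsto`).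

*The limit equation.* The subgradient inequality passes to the limit as
`E(f) - E(g) ≤ S(f) (f, f - g)` for all `g`, and Minty's argument turns it into the stationary
equation (`solvesStationary_of_energy_sub_energy_le`).

Rellich's theorem is proved for test functions by replacing them by their means over the cells of a
fine grid: the error is of the order of the mesh size times the norm of the gradient
(`lintegral_sub_cellMean_sq_le`), and the means lie in a bounded subset of a finite-dimensional
space.
-/

noncomputable section

namespace ConstrainedHeat

variable {d : ℕ}

/-! ### Convexity and monotonicity inequalities for real powers -/

lemma abs_rpow_sub_two_mul_mul_self {p : ℝ} (hp : 2 ≤ p) (a : ℝ) :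
    |a| ^ (p - 2) * a * a = |a| ^ p := by
  have h : |a| ^ p = |a| ^ (p - 2) * |a| ^ (2 : ℝ) := by
    rw [← Real.rpow_add_of_nonneg (abs_nonneg a) (by linarith) (by norm_num)]
    congr 1; ring
  rw [h, Real.rpow_two, sq_abs]
  ring

lemma abs_rpow_sub_two_mul_abs {p : ℝ} (hp : 2 ≤ p) (a : ℝ) :
    |a| ^ (p - 2) * |a| = |a| ^ (p - 1) := by
  have h : |a| ^ (p - 1) = |a| ^ (p - 2) * |a| ^ (1 : ℝ) := by
    rw [← Real.rpow_add_of_nonneg (abs_nonneg a) (by linarith) (by norm_num)]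
    congr 1; ring
  rw [h, Real.rpow_one]

/-- The tangent line inequality for the convex function `|·|^p`, a form of Young's inequality. -/
lemma abs_rpow_sub_abs_rpow_le {p : ℝ} (hp : 2 ≤ p) (a b : ℝ) :
    |a| ^ p - |b| ^ p ≤ p * (|a| ^ (p - 2) * a * (a - b)) := by
  have hpq : p.HolderConjugate (p / (p - 1)) := Real.HolderConjugate.conjExponent (by linarith)
  have hy := Real.young_inequality_of_nonneg (abs_nonneg b)
    (Real.rpow_nonneg (abs_nonneg a) (p - 1)) hpq
  have e : (|a| ^ (p - 1)) ^ (p / (p - 1)) = |a| ^ p := by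
    rw [← Real.rpow_mul (abs_nonneg a)]
    congr 1
    field_simp [show p - 1 ≠ 0 by linarith]
  have h1 : |a| ^ (p - 2) * a * b ≤ |b| * |a| ^ (p - 1) := by
    rw [← abs_rpow_sub_two_mul_abs hp, mul_assoc, mul_comm |b|, mul_assoc]
    refine mul_le_mul_of_nonneg_left ?_ (by positivity)
    rw [← abs_mul]
    exact le_abs_self _
  have h2 := abs_rpow_sub_two_mul_mul_self hp a
  rw [e] at hy
  have h3 : p * (|b| * |a| ^ (p - 1)) ≤ |b| ^ p + (p - 1) * |a| ^ p := by
    calc p * (|b| * |a| ^ (p - 1)) ≤ p * (|b| ^ p / p + |a| ^ p / (p / (p - 1))) :=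
          mul_le_mul_of_nonneg_left hy (by linarith)
      _ = |b| ^ p + (p - 1) * |a| ^ p := by
          have : p ≠ 0 := by linarith
          field_simp
  have h4 := mul_le_mul_of_nonneg_left h1 (show 0 ≤ p by linarith)
  rw [mul_sub, h2, mul_sub]
  linarith

/-- Strong monotonicity of `a ↦ |a|^{p-2} a`. -/
lemma abs_sub_rpow_le {p : ℝ} (hp : 2 ≤ p) (a b : ℝ) :
    2 ^ (1 - p) * |a - b| ^ p ≤ (|a| ^ (p - 2) * a - |b| ^ (p - 2) * b) * (a - b) := by
  set A := |a| ^ (p - 2) with hA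
  set B := |b| ^ (p - 2) with hB
  have hA0 : 0 ≤ A := by positivity
  have hB0 : 0 ≤ B := by positivity
  have hmono : 0 ≤ (A - B) * (a ^ 2 - b ^ 2) := by
    rcases le_total |a| |b| with h | h
    · have h1 : A ≤ B := Real.rpow_le_rpow (abs_nonneg _) h (by linarith)
      have h2 : a ^ 2 ≤ b ^ 2 := sq_le_sq.2 h
      exact mul_nonneg_of_nonpos_of_nonpos (by linarith) (by linarith)
    · have h1 : B ≤ A := Real.rpow_le_rpow (abs_nonneg _) h (by linarith)
      have h2 : b ^ 2 ≤ a ^ 2 := sq_le_sq.2 h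
      exact mul_nonneg (by linarith) (by linarith)
  have hsum : |a - b| ^ (p - 2) ≤ 2 ^ (p - 2) * (A + B) := by
    have h1 : |a - b| ≤ 2 * max |a| |b| :=
      (abs_sub a b).trans (by linarith [le_max_left |a| |b|, le_max_right |a| |b|])
    refine (Real.rpow_le_rpow (abs_nonneg _) h1 (by linarith)).trans ?_
    rw [Real.mul_rpow (by norm_num) (by positivity)]
    refine mul_le_mul_of_nonneg_left ?_ (by positivity)
    rcases max_choice |a| |b| with h | h <;> rw [h] <;> linarith
  have e1 : |a - b| ^ p = |a - b| ^ (p - 2) * (a - b) ^ 2 := by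
    rw [← abs_rpow_sub_two_mul_mul_self hp]; ring
  have e2 : (2 : ℝ) ^ (1 - p) * 2 ^ (p - 2) = 1 / 2 := by
    rw [← Real.rpow_add (by norm_num), show 1 - p + (p - 2) = -1 by ring, Real.rpow_neg_one]
    norm_num
  -- `2 (A a - B b) (a - b) = (A + B) (a - b)² + (A - B) (a² - b²)`
  have h3 : 2 ^ (1 - p) * |a - b| ^ p ≤ 1 / 2 * (A + B) * (a - b) ^ 2 := by
    rw [e1, ← mul_assoc]
    refine mul_le_mul_of_nonneg_right ?_ (sq_nonneg _)
    calc (2 : ℝ) ^ (1 - p) * |a - b| ^ (p - 2) ≤ 2 ^ (1 - p) * (2 ^ (p - 2) * (A + B)) :=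
          mul_le_mul_of_nonneg_left hsum (by positivity)
      _ = _ := by rw [← mul_assoc, e2]
  nlinarith

/-! ### The energy and its subgradient -/

variable {O : Set (Rd d)} {p : ℝ}

lemma wgrad_mem_graph {f : L2 O} (hf : f ∈ H01 O) : (f, wgrad f) ∈ H01Graph O := by
  have hex := mem_H01_iff.1 hf
  rw [wgrad, dif_pos hex]
  exact hex.choose_spec

lemma wgrad_sub (hO : IsOpen O) {f g : L2 O} (hf : f ∈ H01 O) (hg : g ∈ H01 O) :
    wgrad (f - g) = wgrad f - wgrad g :=
  wgrad_eq hO ((H01Graph O).sub_mem (wgrad_mem_graph hf) (wgrad_mem_graph hg))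

lemma wgrad_add (hO : IsOpen O) {f g : L2 O} (hf : f ∈ H01 O) (hg : g ∈ H01 O) :
    wgrad (f + g) = wgrad f + wgrad g :=
  wgrad_eq hO ((H01Graph O).add_mem (wgrad_mem_graph hf) (wgrad_mem_graph hg))

lemma wgrad_smul (hO : IsOpen O) {f : L2 O} (hf : f ∈ H01 O) (c : ℝ) :
    wgrad (c • f) = c • wgrad f :=
  wgrad_eq hO ((H01Graph O).smul_mem c (wgrad_mem_graph hf))

lemma MemV.sub {f g : L2 O} (hf : MemV p f) (hg : MemV p g) : MemV p (f - g) :=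
  ⟨(H01 O).sub_mem hf.1 hg.1, (memLp_congr_ae (Lp.coeFn_sub f g)).2 (hf.2.sub hg.2)⟩

lemma MemV.add {f g : L2 O} (hf : MemV p f) (hg : MemV p g) : MemV p (f + g) :=
  ⟨(H01 O).add_mem hf.1 hg.1, (memLp_congr_ae (Lp.coeFn_add f g)).2 (hf.2.add hg.2)⟩

lemma MemV.smul {f : L2 O} (hf : MemV p f) (c : ℝ) : MemV p (c • f) :=
  ⟨(H01 O).smul_mem c hf.1, (memLp_congr_ae (Lp.coeFn_smul c f)).2 (hf.2.const_smul c)⟩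

lemma integrable_abs_rpow_of_memLp {μ : Measure (Rd d)} {f : Rd d → ℝ} (hp : 0 < p)
    (hf : MemLp f (ENNReal.ofReal p) μ) : Integrable (fun x => |f x| ^ p) μ := by
  have := hf.integrable_norm_rpow (by simpa using hp) (by simp)
  simpa [ENNReal.toReal_ofReal hp.le] using this

/-- The energy `½‖∇f‖² + (1/p)‖f‖_p^p`, whose `L²` gradient flow constrained to the unit sphere
is the equation under study. -/
def energy (p : ℝ) (f : L2 O) : ℝ := ‖wgrad f‖ ^ 2 / 2 + (∫ x in O, |f x| ^ p) / p

lemma S_le_mul_energy (hp : 2 ≤ p) (f : L2 O) : S p f ≤ p * energy p f := by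
  have : p ≠ 0 := by linarith
  have e : p * energy p f = p / 2 * ‖wgrad f‖ ^ 2 + ∫ x in O, |f x| ^ p := by
    rw [energy]; field_simp
  rw [e, S]
  nlinarith [sq_nonneg ‖wgrad f‖]

lemma S_nonneg (f : L2 O) : 0 ≤ S p f :=
  add_nonneg (sq_nonneg _) (integral_nonneg fun x => by positivity)

lemma energy_nonneg (hp : 2 ≤ p) (f : L2 O) : 0 ≤ energy p f :=
  add_nonneg (by positivity)
    (div_nonneg (integral_nonneg fun x => by positivity) (by linarith))

/-- Elements of the domain of the subdifferential of the energy in `L²(O)`, on which the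
subdifferential is the square integrable function `|f|^{p-2} f - Δf`. -/
structure IsRegular (p : ℝ) (f : L2 O) : Prop where
  hasLap : HasLaplacian f (lap f)
  memV : MemV p f
  memLp_powFun : MemLp (powFun p f) 2 (leb O)

lemma hasLaplacian_lap {f : L2 O} (hf : f ∈ DomA O) : HasLaplacian f (lap f) := by
  have hex : ∃ h, HasLaplacian f h := hf
  rw [lap, dif_pos hex]
  exact hex.choose_spec

lemma powL2_coeFn {f : L2 O} (hf : MemLp (powFun p f) 2 (leb O)) :
    (powL2 p f : Rd d → ℝ) =ᵐ[leb O] powFun p f := by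
  rw [powL2, dif_pos hf]
  exact hf.coeFn_toLp

lemma inner_L2_eq (f g : L2 O) : (inner ℝ f g : ℝ) = ∫ x in O, f x * g x := by
  rw [L2.inner_def]
  exact integral_congr_ae (Eventually.of_forall fun x => by simp [mul_comm])

lemma integrable_mul_L2 (f g : L2 O) : Integrable (fun x => f x * g x) (leb O) :=
  (Lp.memLp f).integrable_mul (Lp.memLp g)

lemma integral_abs_rpow_sub_le (hp : 2 ≤ p) {f g h : L2 O}
    (hf : MemLp f (ENNReal.ofReal p) (leb O)) (hg : MemLp g (ENNReal.ofReal p) (leb O))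
    (hh : (h : Rd d → ℝ) =ᵐ[leb O] powFun p f) :
    (∫ x in O, |f x| ^ p) / p - (∫ x in O, |g x| ^ p) / p ≤ inner ℝ h (f - g) := by
  have hp0 : 0 < p := by linarith
  rw [← sub_div, div_le_iff₀ hp0, inner_L2_eq, ← integral_sub
    (integrable_abs_rpow_of_memLp hp0 hf) (integrable_abs_rpow_of_memLp hp0 hg),
    ← integral_mul_const]
  refine integral_mono_ae ((integrable_abs_rpow_of_memLp hp0 hf).sub
    (integrable_abs_rpow_of_memLp hp0 hg)) ((integrable_mul_L2 h (f - g)).mul_const p) ?_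
  filter_upwards [hh, Lp.coeFn_sub f g] with x h1 h2
  simp only [h1, h2, powFun, Pi.sub_apply]
  linarith [abs_rpow_sub_abs_rpow_le hp (f x) (g x)]

/-- The subgradient inequality for the energy. -/
lemma energy_sub_energy_le (hO : IsOpen O) (hp : 2 ≤ p) {f g : L2 O} (hf : IsRegular p f)
    (hg : MemV p g) : energy p f - energy p g ≤ inner ℝ (powL2 p f - lap f) (f - g) := by
  have h1 := integral_abs_rpow_sub_le hp hf.memV.2 hg.2 (powL2_coeFn hf.memLp_powFun)
  have h2 := hf.hasLap.2 _ ((H01 O).sub_mem hf.memV.1 hg.1)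
  rw [wgrad_sub hO hf.memV.1 hg.1, inner_sub_right, real_inner_self_eq_norm_sq] at h2
  have h3 : inner ℝ (wgrad f) (wgrad g) ≤ ‖wgrad f‖ ^ 2 / 2 + ‖wgrad g‖ ^ 2 / 2 := by
    have := real_inner_le_norm (wgrad f) (wgrad g)
    nlinarith [sq_nonneg (‖wgrad f‖ - ‖wgrad g‖)]
  rw [inner_sub_left (powL2 p f), energy, energy]
  linarith

lemma mul_integral_abs_sub_rpow_le (hp : 2 ≤ p) {f g : L2 O} (hf : IsRegular p f)
    (hg : IsRegular p g) :
    2 ^ (1 - p) * ∫ x in O, |(f - g : L2 O) x| ^ p ≤ inner ℝ (powL2 p f - powL2 p g) (f - g) := by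
  have hp0 : 0 < p := by linarith
  rw [inner_L2_eq, ← integral_const_mul]
  refine integral_mono_ae ((integrable_abs_rpow_of_memLp hp0 (hf.memV.sub hg.memV).2).const_mul _)
    (integrable_mul_L2 _ _) ?_
  filter_upwards [powL2_coeFn hf.memLp_powFun, powL2_coeFn hg.memLp_powFun,
    Lp.coeFn_sub f g, Lp.coeFn_sub (powL2 p f) (powL2 p g)] with x h1 h2 h3 h4
  simp only [h1, h2, h3, h4, powFun, Pi.sub_apply]
  exact abs_sub_rpow_le hp _ _

/-- Strong monotonicity of the subdifferential of the energy. -/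
lemma norm_wgrad_sub_add_le (hO : IsOpen O) (hp : 2 ≤ p) {f g : L2 O} (hf : IsRegular p f)
    (hg : IsRegular p g) :
    ‖wgrad (f - g)‖ ^ 2 + 2 ^ (1 - p) * ∫ x in O, |(f - g : L2 O) x| ^ p ≤
      inner ℝ ((powL2 p f - lap f) - (powL2 p g - lap g)) (f - g) := by
  have h1 := mul_integral_abs_sub_rpow_le hp hf hg
  have hs := (H01 O).sub_mem hf.memV.1 hg.memV.1
  have h2 := hf.hasLap.2 _ hs
  have h3 := hg.hasLap.2 _ hs
  have h4 : ‖wgrad (f - g)‖ ^ 2 = inner ℝ (wgrad f) (wgrad (f - g))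
      - inner ℝ (wgrad g) (wgrad (f - g)) := by
    rw [← inner_sub_left, ← wgrad_sub hO hf.memV.1 hg.memV.1, real_inner_self_eq_norm_sq]
  rw [h4]
  rw [inner_sub_left] at h1
  rw [inner_sub_left, inner_sub_left, inner_sub_left]
  linarith

/-! ### Averages over the cells of a grid -/

lemma sq_lintegral_le {α : Type*} [MeasurableSpace α] {μ : Measure α} {f : α → ℝ≥0∞}
    (hf : AEMeasurable f μ) : (∫⁻ x, f x ∂μ) ^ 2 ≤ μ univ * ∫⁻ x, f x ^ 2 ∂μ := by
  have h := ENNReal.lintegral_mul_le_Lp_mul_Lq μ Real.HolderConjugate.two_two hf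
    (aemeasurable_const (b := (1 : ℝ≥0∞)))
  simp only [Pi.mul_apply, mul_one, ENNReal.rpow_two, one_pow, lintegral_one] at h
  calc (∫⁻ x, f x ∂μ) ^ 2
      ≤ ((∫⁻ x, f x ^ 2 ∂μ) ^ (1 / 2 : ℝ) * μ univ ^ (1 / 2 : ℝ)) ^ 2 := by gcongr
    _ = μ univ * ∫⁻ x, f x ^ 2 ∂μ := by
      rw [mul_pow, ← ENNReal.rpow_two, ← ENNReal.rpow_two, ← ENNReal.rpow_mul, ← ENNReal.rpow_mul]
      norm_num [mul_comm]

lemma enorm_sq_Lp {α E : Type*} [MeasurableSpace α] {μ : Measure α} [NormedAddCommGroup E]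
    (f : Lp E 2 μ) : ‖f‖ₑ ^ 2 = ∫⁻ x, ‖f x‖ₑ ^ 2 ∂μ := by
  rw [Lp.enorm_def, eLpNorm_eq_lintegral_rpow_enorm_toReal (by norm_num) (by norm_num),
    ← ENNReal.rpow_two, ← ENNReal.rpow_mul]
  norm_num

/-- Translating a `C¹` function by `z` moves it by at most `‖z‖ ‖∇φ‖` in `L²`. -/
lemma lintegral_translate_sub_sq_le {φ : Rd d → ℝ} (hφ : ContDiff ℝ ∞ φ) (z : Rd d) :
    ∫⁻ x, ‖φ x - φ (x + z)‖ₑ ^ 2 ≤ ‖z‖ₑ ^ 2 * ∫⁻ x, ‖fderiv ℝ φ x‖ₑ ^ 2 := by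
  have hc : Continuous (fderiv ℝ φ) := hφ.continuous_fderiv (by simp)
  have hpt (x : Rd d) : ‖φ x - φ (x + z)‖ₑ ^ 2 ≤
      ∫⁻ t in Ioc (0 : ℝ) 1, ‖z‖ₑ ^ 2 * ‖fderiv ℝ φ (x + t • z)‖ₑ ^ 2 := by
    have hcx : Continuous fun t : ℝ => fderiv ℝ φ (x + t • z) :=
      hc.comp (by fun_prop)
    have h1 : φ (x + z) - φ x = ∫ t in (0 : ℝ)..1, fderiv ℝ φ (x + t • z) z := by
      have hd (t : ℝ) : HasDerivAt (fun t : ℝ => φ (x + t • z)) (fderiv ℝ φ (x + t • z) z) t := by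
        have h2 : HasDerivAt (fun t : ℝ => x + t • z) z t := by
          simpa using ((hasDerivAt_id t).smul_const z).const_add x
        exact ((hφ.differentiable (by simp)) _).hasFDerivAt.comp_hasDerivAt t h2
      rw [intervalIntegral.integral_eq_sub_of_hasDerivAt (fun t _ => hd t)]
      · simp
      · exact (hcx.clm_apply continuous_const).intervalIntegrable _ _
    have h2 : ‖φ x - φ (x + z)‖ₑ ≤ ∫⁻ t in Ioc (0 : ℝ) 1, ‖z‖ₑ * ‖fderiv ℝ φ (x + t • z)‖ₑ := by
      rw [enorm_sub_rev, h1, intervalIntegral.integral_of_le zero_le_one]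
      refine (enorm_integral_le_lintegral_enorm _).trans (lintegral_mono fun t => ?_)
      rw [mul_comm]
      exact ContinuousLinearMap.le_opENorm _ _
    calc ‖φ x - φ (x + z)‖ₑ ^ 2
        ≤ (∫⁻ t in Ioc (0 : ℝ) 1, ‖z‖ₑ * ‖fderiv ℝ φ (x + t • z)‖ₑ) ^ 2 := by gcongr
      _ ≤ volume.restrict (Ioc (0 : ℝ) 1) univ *
          ∫⁻ t in Ioc (0 : ℝ) 1, (‖z‖ₑ * ‖fderiv ℝ φ (x + t • z)‖ₑ) ^ 2 :=
        sq_lintegral_le (hcx.enorm.measurable.const_mul _).aemeasurable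
      _ = _ := by simp [mul_pow]
  have hm : Measurable fun q : Rd d × ℝ => ‖z‖ₑ ^ 2 * ‖fderiv ℝ φ (q.1 + q.2 • z)‖ₑ ^ 2 := by
    have : Continuous fun q : Rd d × ℝ => fderiv ℝ φ (q.1 + q.2 • z) := hc.comp (by fun_prop)
    exact (this.enorm.measurable.pow_const 2).const_mul _
  calc ∫⁻ x, ‖φ x - φ (x + z)‖ₑ ^ 2
      ≤ ∫⁻ x, ∫⁻ t in Ioc (0 : ℝ) 1, ‖z‖ₑ ^ 2 * ‖fderiv ℝ φ (x + t • z)‖ₑ ^ 2 :=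
        lintegral_mono hpt
    _ = ∫⁻ t in Ioc (0 : ℝ) 1, ∫⁻ x, ‖z‖ₑ ^ 2 * ‖fderiv ℝ φ (x + t • z)‖ₑ ^ 2 :=
        lintegral_lintegral_swap hm.aemeasurable
    _ = ∫⁻ t in Ioc (0 : ℝ) 1, ‖z‖ₑ ^ 2 * ∫⁻ x, ‖fderiv ℝ φ x‖ₑ ^ 2 := by
        refine lintegral_congr fun t => ?_
        rw [lintegral_const_mul' _ _ (by simp),
          lintegral_add_right_eq_self (fun x => ‖fderiv ℝ φ x‖ₑ ^ 2)]
    _ = _ := by simp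

/-- The index of the cell containing `x` in the grid of half-open cubes of side `h`. -/
def gridIndex (h : ℝ) (x : Rd d) : Fin d → ℤ := fun i => ⌊x i / h⌋

lemma measurable_gridIndex (h : ℝ) : Measurable (gridIndex (d := d) h) := by
  refine measurable_pi_lambda _ fun i => ?_
  have : Measurable fun x : Rd d => x i := (EuclideanSpace.proj i).continuous.measurable
  exact (this.div_const h).floor

/-- The cell of index `k` in the grid of half-open cubes of side `h`. -/
def gridCell (h : ℝ) (k : Fin d → ℤ) : Set (Rd d) := gridIndex h ⁻¹' {k}

lemma measurableSet_gridCell (h : ℝ) (k : Fin d → ℤ) : MeasurableSet (gridCell h k) :=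
  measurable_gridIndex h (measurableSet_singleton k)

lemma volume_gridCell {h : ℝ} (hh : 0 < h) (k : Fin d → ℤ) :
    volume (gridCell h k) = ENNReal.ofReal h ^ d := by
  have e : gridCell h k = (MeasurableEquiv.toLp 2 (Fin d → ℝ)).symm ⁻¹'
      (Set.pi univ fun i => Ico (k i * h) ((k i + 1) * h)) := by
    ext x
    simp only [gridCell, mem_preimage, mem_singleton_iff, gridIndex, funext_iff, Int.floor_eq_iff,
      Set.mem_pi, mem_univ, forall_const, mem_Ico, le_div_iff₀ hh, div_lt_iff₀ hh]
    rfl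
  rw [e, (EuclideanSpace.volume_preserving_symm_measurableEquiv_toLp (Fin d)).measure_preimage
    (MeasurableSet.univ_pi fun i => measurableSet_Ico).nullMeasurableSet, Real.volume_pi_Ico]
  simp [show ∀ i, ((k i : ℝ) + 1) * h - k i * h = h from fun i => by ring]

/-- The cube of side `2h` centred at the origin, which contains the differences of points in a
common cell. -/
def centredCube (d : ℕ) (h : ℝ) : Set (Rd d) := {z | ∀ i, z i ∈ Icc (-h) h}

lemma centredCube_eq (h : ℝ) : centredCube d h = (MeasurableEquiv.toLp 2 (Fin d → ℝ)).symm ⁻¹'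
      (Set.pi univ fun _ => Icc (-h) h) := by
  ext x
  simp only [centredCube, mem_ofPred_eq, mem_preimage, Set.mem_pi, mem_univ, forall_const]
  rfl

lemma measurableSet_centredCube (h : ℝ) : MeasurableSet (centredCube d h) := by
  rw [centredCube_eq]
  exact (MeasurableEquiv.measurable _) (MeasurableSet.univ_pi fun i => measurableSet_Icc)

lemma volume_centredCube (h : ℝ) : volume (centredCube d h) = ENNReal.ofReal (2 * h) ^ d := by
  rw [centredCube_eq, (EuclideanSpace.volume_preserving_symm_measurableEquiv_toLp
    (Fin d)).measure_preimage
    (MeasurableSet.univ_pi fun i => measurableSet_Icc).nullMeasurableSet, volume_pi_pi]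
  simp [show h + h = 2 * h by ring]

lemma enorm_sq_le_of_mem_centredCube {h : ℝ} {z : Rd d} (hz : z ∈ centredCube d h) :
    ‖z‖ₑ ^ 2 ≤ ENNReal.ofReal (d * h ^ 2) := by
  have : ‖z‖ ^ 2 ≤ d * h ^ 2 := by
    rw [EuclideanSpace.norm_sq_eq]
    refine (Finset.sum_le_card_nsmul _ _ (h ^ 2) fun i _ => ?_).trans (by simp)
    rw [Real.norm_eq_abs]
    exact pow_le_pow_left₀ (abs_nonneg _) (abs_le.2 (hz i)) 2
  rw [← ofReal_norm, ← ENNReal.ofReal_pow (norm_nonneg _)]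
  exact ENNReal.ofReal_le_ofReal this

lemma mem_centredCube_of_gridIndex_eq {h : ℝ} (hh : 0 < h) {x z : Rd d}
    (hz : gridIndex h (x + z) = gridIndex h x) : z ∈ centredCube d h := by
  intro i
  have h1 := Int.abs_sub_lt_one_of_floor_eq_floor (congrFun hz i)
  rw [← sub_div, abs_div, abs_of_pos hh, div_lt_one hh] at h1
  simp only [PiLp.add_apply, add_sub_cancel_left] at h1
  exact abs_le.1 h1.le

/-- The mean of `φ` over the cell of index `k`. -/
def cellMean (h : ℝ) (φ : Rd d → ℝ) (k : Fin d → ℤ) : ℝ := ⨍ y in gridCell h k, φ y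

lemma enorm_sub_cellMean_sq_le {h : ℝ} (hh : 0 < h) {φ : Rd d → ℝ} (hφ : Continuous φ)
    (hc : HasCompactSupport φ) (a : ℝ) (k : Fin d → ℤ) :
    ‖a - cellMean h φ k‖ₑ ^ 2 ≤
      (ENNReal.ofReal h ^ d)⁻¹ * ∫⁻ y in gridCell h k, ‖a - φ y‖ₑ ^ 2 := by
  have hv := volume_gridCell hh k
  set c := ENNReal.ofReal h ^ d with hcdef
  have hc0 : c ≠ 0 := pow_ne_zero _ (by simpa using hh)
  have hct : c ≠ ⊤ := ENNReal.pow_ne_top (by simp)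
  have hconst : Integrable (fun _ => a) (volume.restrict (gridCell h k)) :=
    integrableOn_const (by rw [hv]; exact hct)
  have e : a - cellMean h φ k = ⨍ y in gridCell h k, (a - φ y) := by
    rw [cellMean, setAverage_eq, setAverage_eq, integral_sub hconst
      (hφ.integrable_of_hasCompactSupport hc).integrableOn, smul_sub, setIntegral_const, smul_smul,
      inv_mul_cancel₀, one_smul]
    rw [Measure.real, hv]
    exact (ENNReal.toReal_pos hc0 hct).ne'
  have h1 : ‖a - cellMean h φ k‖ₑ ≤ c⁻¹ * ∫⁻ y in gridCell h k, ‖a - φ y‖ₑ := by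
    rw [e, setAverage_eq, enorm_smul]
    refine mul_le_mul' (le_of_eq ?_) (enorm_integral_le_lintegral_enorm _)
    rw [Measure.real, hv, enorm_inv (ENNReal.toReal_pos hc0 hct).ne', Real.enorm_toReal hct]
  have hm : Measurable fun y => ‖a - φ y‖ₑ := (continuous_const.sub hφ).enorm.measurable
  calc ‖a - cellMean h φ k‖ₑ ^ 2 ≤ (c⁻¹ * ∫⁻ y in gridCell h k, ‖a - φ y‖ₑ) ^ 2 := by gcongr
    _ = c⁻¹ ^ 2 * (∫⁻ y in gridCell h k, ‖a - φ y‖ₑ) ^ 2 := mul_pow _ _ _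
    _ ≤ c⁻¹ ^ 2 * (c * ∫⁻ y in gridCell h k, ‖a - φ y‖ₑ ^ 2) := by
        have := sq_lintegral_le (μ := volume.restrict (gridCell h k)) hm.aemeasurable
        rw [Measure.restrict_apply_univ, hv] at this
        gcongr
    _ = c⁻¹ * ∫⁻ y in gridCell h k, ‖a - φ y‖ₑ ^ 2 := by
        rw [← mul_assoc, pow_two, mul_assoc c⁻¹, ENNReal.inv_mul_cancel hc0 hct, mul_one]

/-- Replacing a function by its means over the cells of a grid of side `h` costs at most a
constant times `h ‖∇φ‖` in `L²`. -/
lemma lintegral_sub_cellMean_sq_le {h : ℝ} (hh : 0 < h) {φ : Rd d → ℝ} (hφ : ContDiff ℝ ∞ φ)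
    (hc : HasCompactSupport φ) :
    ∫⁻ x, ‖φ x - cellMean h φ (gridIndex h x)‖ₑ ^ 2 ≤
      2 ^ d * ENNReal.ofReal (d * h ^ 2) * ∫⁻ x, ‖fderiv ℝ φ x‖ₑ ^ 2 := by
  set c := ENNReal.ofReal h ^ d with hcdef
  set D := ∫⁻ x, ‖fderiv ℝ φ x‖ₑ ^ 2
  have hc0 : c ≠ 0 := pow_ne_zero _ (by simpa using hh)
  have hct : c ≠ ⊤ := ENNReal.pow_ne_top (by simp)
  have hpt (x : Rd d) : ‖φ x - cellMean h φ (gridIndex h x)‖ₑ ^ 2 ≤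
      c⁻¹ * ∫⁻ z in centredCube d h, ‖φ x - φ (x + z)‖ₑ ^ 2 := by
    refine (enorm_sub_cellMean_sq_le hh hφ.continuous hc _ _).trans ?_
    gcongr c⁻¹ * ?_
    rw [← lintegral_indicator (measurableSet_gridCell _ _),
      ← lintegral_indicator (measurableSet_centredCube _), ← lintegral_add_left_eq_self _ x]
    refine lintegral_mono fun z => ?_
    by_cases hz : x + z ∈ gridCell h (gridIndex h x)
    · have hz' : z ∈ centredCube d h := mem_centredCube_of_gridIndex_eq hh hz
      simp [hz, hz']
    · simp [hz]
  have hm : Measurable fun q : Rd d × Rd d => ‖φ q.1 - φ (q.1 + q.2)‖ₑ ^ 2 := by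
    have hcφ := hφ.continuous
    have : Continuous fun q : Rd d × Rd d => φ q.1 - φ (q.1 + q.2) := by fun_prop
    exact this.enorm.measurable.pow_const 2
  calc ∫⁻ x, ‖φ x - cellMean h φ (gridIndex h x)‖ₑ ^ 2
      ≤ ∫⁻ x, c⁻¹ * ∫⁻ z in centredCube d h, ‖φ x - φ (x + z)‖ₑ ^ 2 := lintegral_mono hpt
    _ = c⁻¹ * ∫⁻ z in centredCube d h, ∫⁻ x, ‖φ x - φ (x + z)‖ₑ ^ 2 := by
        rw [lintegral_const_mul' _ _ (ENNReal.inv_ne_top.2 hc0),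
          lintegral_lintegral_swap hm.aemeasurable]
    _ ≤ c⁻¹ * ∫⁻ z in centredCube d h, ENNReal.ofReal (d * h ^ 2) * D := by
        gcongr c⁻¹ * ?_
        refine setLIntegral_mono measurable_const fun z hz => ?_
        refine (lintegral_translate_sub_sq_le hφ z).trans ?_
        gcongr
        exact enorm_sq_le_of_mem_centredCube hz
    _ = 2 ^ d * ENNReal.ofReal (d * h ^ 2) * D := by
        rw [setLIntegral_const, volume_centredCube, ENNReal.ofReal_mul two_pos.le,
          mul_pow _ (ENNReal.ofReal h), ← hcdef, mul_comm (_ * D), ← mul_assoc,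
          ← mul_assoc, mul_comm c⁻¹, mul_assoc _ c,
          ENNReal.mul_inv_cancel hc0 hct]
        simp

/-! ### Compactness of the embedding of `H¹₀(O)` in `L²(O)` -/

/-- The test functions `φ`, as elements of `L²(O)`, with `‖φ‖ ≤ M` and `‖∇φ‖ ≤ M` in `L²`. Both
bounds are stated for extended nonnegative integrals. -/
def boundedTest (O : Set (Rd d)) (M : ℝ) : Set (L2 O) :=
  {f | ∃ φ, IsTest O φ ∧ (f : Rd d → ℝ) =ᵐ[leb O] φ ∧ ‖f‖ₑ ^ 2 ≤ ENNReal.ofReal (M ^ 2) ∧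
    ∫⁻ x, ‖fderiv ℝ φ x‖ₑ ^ 2 ≤ ENNReal.ofReal (M ^ 2)}

lemma IsTest.lintegral_eq_enorm_sq {O : Set (Rd d)} {φ : Rd d → ℝ} (hφ : IsTest O φ) {f : L2 O}
    (hf : (f : Rd d → ℝ) =ᵐ[leb O] φ) : ∫⁻ x, ‖φ x‖ₑ ^ 2 = ‖f‖ₑ ^ 2 := by
  have hs : Function.support (fun x => ‖φ x‖ₑ ^ 2) ⊆ O := by
    refine subset_trans ?_ hφ.2.2
    intro x hx
    refine subset_tsupport φ fun h0 => hx ?_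
    simp [h0]
  rw [enorm_sq_Lp, ← setLIntegral_eq_of_support_subset hs]
  exact lintegral_congr_ae (hf.mono fun x hx => by simp [hx])

/-- The step function on the grid of side `h` taking the value `a k` on the cell of index `k`, for
`k` in the finite set `s`, and vanishing on the other cells. -/
def stepFun (O : Set (Rd d)) [IsFiniteMeasure (leb O)] (h : ℝ) (s : Finset (Fin d → ℤ))
    (a : s → ℝ) : L2 O :=
  ∑ k, a k • indicatorConstLp 2 (measurableSet_gridCell h k.1) (measure_ne_top (leb O) _) (1 : ℝ)

lemma continuous_stepFun (O : Set (Rd d)) [IsFiniteMeasure (leb O)] (h : ℝ)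
    (s : Finset (Fin d → ℤ)) : Continuous (stepFun O h s) := by
  unfold stepFun
  fun_prop

lemma stepFun_coeFn (O : Set (Rd d)) [IsFiniteMeasure (leb O)] (h : ℝ)
    (s : Finset (Fin d → ℤ)) (a : (Fin d → ℤ) → ℝ) (hs : ∀ x ∈ O, gridIndex h x ∈ s)
    (hO : MeasurableSet O) :
    (stepFun O h s (fun k => a k) : Rd d → ℝ) =ᵐ[leb O] fun x => a (gridIndex h x) := by
  have h1 : (stepFun O h s (fun k => a k) : Rd d → ℝ) =ᵐ[leb O] ∑ k : s,
      (a k • indicatorConstLp 2 (measurableSet_gridCell h k.1) (measure_ne_top (leb O) _) (1 : ℝ) :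
        L2 O) := Lp.coeFn_finsetSum _ _
  have h2 : ∀ᵐ x ∂(leb O), ∀ k : s, (a k • indicatorConstLp 2 (measurableSet_gridCell h k.1)
      (measure_ne_top (leb O) _) (1 : ℝ) : L2 O) x =
        a k * (gridCell h k.1).indicator (fun _ => (1 : ℝ)) x := by
    refine ae_all_iff.2 fun k => ?_
    filter_upwards [Lp.coeFn_smul (a k) (indicatorConstLp 2 (measurableSet_gridCell h k.1)
      (measure_ne_top (leb O) _) (1 : ℝ)), indicatorConstLp_coeFn (p := 2)
      (hs := measurableSet_gridCell h k.1) (hμs := measure_ne_top (leb O) _) (c := (1 : ℝ))]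
      with x hx1 hx2
    rw [hx1, Pi.smul_apply, hx2, smul_eq_mul]
  filter_upwards [h1, h2, ae_restrict_mem hO] with x hx1 hx2 hxO
  rw [hx1, Finset.sum_apply, Finset.sum_congr rfl fun k _ => hx2 k,
    Finset.sum_eq_single (⟨gridIndex h x, hs x hxO⟩ : s)]
  · simp [gridCell]
  · intro k _ hk
    have : x ∉ gridCell h k.1 := fun hx => hk (Subtype.ext (Eq.symm hx))
    simp [this]
  · simp

lemma exists_finset_gridIndex_mem {O : Set (Rd d)} (hO : Bornology.IsBounded O) {h : ℝ}
    (hh : 0 < h) : ∃ s : Finset (Fin d → ℤ), ∀ x ∈ O, gridIndex h x ∈ s := by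
  obtain ⟨R, hR⟩ := hO.exists_norm_le
  refine ⟨Finset.Icc (fun _ => ⌊-R / h⌋) (fun _ => ⌊R / h⌋), fun x hx => ?_⟩
  have hi (i : Fin d) : -R ≤ x i ∧ x i ≤ R := abs_le.1 ((PiLp.norm_apply_le x i).trans (hR x hx))
  rw [Finset.mem_Icc]
  constructor
  · exact fun i => Int.floor_mono (div_le_div_of_nonneg_right (hi i).1 hh.le)
  · exact fun i => Int.floor_mono (div_le_div_of_nonneg_right (hi i).2 hh.le)

lemma abs_cellMean_le {h : ℝ} (hh : 0 < h) {φ : Rd d → ℝ} (hφ : Continuous φ)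
    (hc : HasCompactSupport φ) {M : ℝ} (hM : ∫⁻ x, ‖φ x‖ₑ ^ 2 ≤ ENNReal.ofReal (M ^ 2))
    (k : Fin d → ℤ) :
    |cellMean h φ k| ≤ ((ENNReal.ofReal h ^ d)⁻¹ * ENNReal.ofReal (M ^ 2)).toReal + 1 := by
  have h1 := enorm_sub_cellMean_sq_le hh hφ hc 0 k
  simp only [zero_sub, enorm_neg] at h1
  have hc0 : ENNReal.ofReal h ^ d ≠ 0 := pow_ne_zero _ (by simpa using hh)
  have h2 : ‖cellMean h φ k‖ₑ ^ 2 ≤ (ENNReal.ofReal h ^ d)⁻¹ * ENNReal.ofReal (M ^ 2) :=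
    h1.trans (mul_le_mul_right ((setLIntegral_le_lintegral _ _).trans hM) _)
  have h3 := ENNReal.toReal_mono
    (ENNReal.mul_ne_top (ENNReal.inv_ne_top.2 hc0) ENNReal.ofReal_ne_top) h2
  rw [ENNReal.toReal_pow, toReal_enorm, Real.norm_eq_abs] at h3
  nlinarith [sq_nonneg (|cellMean h φ k| - 1), abs_nonneg (cellMean h φ k)]

/-- Test functions bounded in `H¹₀(O)` are totally bounded in `L²(O)`: up to a small error, they
lie in a bounded set of the finite-dimensional space of step functions on a fine grid. -/
lemma totallyBounded_boundedTest {O : Set (Rd d)} (hO : IsOpen O) (hb : Bornology.IsBounded O)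
    (M : ℝ) : TotallyBounded (boundedTest O M) := by
  have : IsFiniteMeasure (leb O) := ⟨by simpa using hb.measure_lt_top⟩
  rw [Metric.totallyBounded_iff]
  intro ε hε
  obtain ⟨h, hh, hsmall⟩ : ∃ h : ℝ, 0 < h ∧ 2 ^ d * (d * h ^ 2) * M ^ 2 < (ε / 2) ^ 2 := by
    have hcont : Tendsto (fun h : ℝ => 2 ^ d * (d * h ^ 2) * M ^ 2) (𝓝[>] 0) (𝓝 0) := by
      have : Continuous (fun h : ℝ => 2 ^ d * (d * h ^ 2) * M ^ 2) := by fun_prop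
      refine (this.tendsto' 0 0 (by simp)).mono_left nhdsWithin_le_nhds
    obtain ⟨h, h1, h2⟩ := ((hcont.eventually (gt_mem_nhds
      (show (0 : ℝ) < (ε / 2) ^ 2 by positivity))).and self_mem_nhdsWithin).exists
    exact ⟨h, h2, h1⟩
  obtain ⟨s, hs⟩ := exists_finset_gridIndex_mem hb hh
  set B := ((ENNReal.ofReal h ^ d)⁻¹ * ENNReal.ofReal (M ^ 2)).toReal + 1
  have hK : TotallyBounded (stepFun O h s '' Icc (fun _ => -B) (fun _ => B)) :=
    (isCompact_Icc.image (continuous_stepFun O h s)).totallyBounded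
  obtain ⟨t, ht, hcov⟩ := Metric.totallyBounded_iff.1 hK (ε / 2) (by positivity)
  refine ⟨t, ht, ?_⟩
  rintro f ⟨φ, hφ, hfφ, hfM, hgM⟩
  have hmean := abs_cellMean_le hh hφ.1.continuous hφ.2.1
    ((hφ.lintegral_eq_enorm_sq hfφ).trans_le hfM)
  have hmem : stepFun O h s (fun k => cellMean h φ k) ∈
      stepFun O h s '' Icc (fun _ => -B) (fun _ => B) :=
    mem_image_of_mem _ ⟨fun k => (abs_le.1 (hmean k)).1, fun k => (abs_le.1 (hmean k)).2⟩
  obtain ⟨y, hy, hfy⟩ := mem_iUnion₂.1 (hcov hmem)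
  refine mem_iUnion₂.2 ⟨y, hy, ?_⟩
  have hdist : ‖f - stepFun O h s (fun k => cellMean h φ k)‖ < ε / 2 := by
    refine lt_of_pow_lt_pow_left₀ 2 (by positivity) (lt_of_le_of_lt ?_ hsmall)
    have h1 : ‖f - stepFun O h s (fun k => cellMean h φ k)‖ₑ ^ 2 ≤
        2 ^ d * ENNReal.ofReal (d * h ^ 2) * ENNReal.ofReal (M ^ 2) := by
      rw [enorm_sq_Lp]
      calc ∫⁻ x in O, ‖(f - stepFun O h s (fun k => cellMean h φ k) : L2 O) x‖ₑ ^ 2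
          = ∫⁻ x in O, ‖φ x - cellMean h φ (gridIndex h x)‖ₑ ^ 2 := by
            refine lintegral_congr_ae ?_
            filter_upwards [Lp.coeFn_sub f (stepFun O h s (fun k => cellMean h φ k)), hfφ,
              stepFun_coeFn O h s (cellMean h φ) hs hO.measurableSet] with x h1 h2 h3
            rw [h1, Pi.sub_apply, h2, h3]
        _ ≤ ∫⁻ x, ‖φ x - cellMean h φ (gridIndex h x)‖ₑ ^ 2 := setLIntegral_le_lintegral _ _
        _ ≤ _ := lintegral_sub_cellMean_sq_le hh hφ.1 hφ.2.1
        _ ≤ _ := by gcongr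
    have h2 := ENNReal.toReal_mono (ENNReal.mul_ne_top (ENNReal.mul_ne_top (by simp)
      ENNReal.ofReal_ne_top) ENNReal.ofReal_ne_top) h1
    rw [ENNReal.toReal_mul, ENNReal.toReal_mul, ENNReal.toReal_ofReal (by positivity),
      ENNReal.toReal_ofReal (by positivity), ENNReal.toReal_pow, toReal_enorm] at h2
    simpa using h2
  rw [Metric.mem_ball] at hfy ⊢
  rw [← dist_eq_norm] at hdist
  linarith [dist_triangle f (stepFun O h s (fun k => cellMean h φ k)) y]

lemma norm_gradient (φ : Rd d → ℝ) (x : Rd d) : ‖gradient φ x‖ = ‖fderiv ℝ φ x‖ := by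
  simp [gradient]

/-- Rellich's theorem for `H¹₀(O)`: a sequence bounded in `H¹₀(O)` has a subsequence converging
in `L²(O)`. -/
theorem exists_tendsto_subseq_of_bounded {O : Set (Rd d)} (hO : IsOpen O)
    (hb : Bornology.IsBounded O) {f : ℕ → L2 O} (hf : ∀ n, f n ∈ H01 O) {M : ℝ}
    (hM : ∀ n, ‖f n‖ ≤ M) (hM' : ∀ n, ‖wgrad (f n)‖ ≤ M) :
    ∃ (g : L2 O) (k : ℕ → ℕ), StrictMono k ∧ Tendsto (f ∘ k) atTop (𝓝 g) := by
  have hmem (n : ℕ) : f n ∈ closure (boundedTest O (M + 1)) := by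
    rw [Metric.mem_closure_iff]
    intro ε hε
    obtain ⟨w, ⟨φ, hφ, h1, h2⟩, hw⟩ := Metric.mem_closure_iff.1 (wgrad_mem_graph (hf n))
      (min ε 1) (by positivity)
    rw [Prod.dist_eq, max_lt_iff, lt_min_iff, lt_min_iff] at hw
    refine ⟨w.1, ⟨φ, hφ, h1, ?_, ?_⟩, hw.1.1⟩
    · rw [← ofReal_norm, ← ENNReal.ofReal_pow (norm_nonneg _)]
      refine ENNReal.ofReal_le_ofReal (pow_le_pow_left₀ (norm_nonneg _) ?_ 2)
      have := norm_le_norm_add_norm_sub' w.1 (f n)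
      have h3 := hw.1.2
      rw [dist_eq_norm, norm_sub_rev] at h3
      linarith [hM n, norm_sub_rev w.1 (f n)]
    · have hs : Function.support (fun x => ‖fderiv ℝ φ x‖ₑ ^ 2) ⊆ O := by
        refine subset_trans ?_ hφ.2.2
        intro x hx
        refine support_fderiv_subset ℝ (f := φ) fun h0 => hx ?_
        change ‖fderiv ℝ φ x‖ₑ ^ 2 = 0
        rw [← ofReal_norm, h0, norm_zero]
        simp
      have e : ∫⁻ x, ‖fderiv ℝ φ x‖ₑ ^ 2 = ‖w.2‖ₑ ^ 2 := by
        rw [enorm_sq_Lp, ← setLIntegral_eq_of_support_subset hs]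
        refine lintegral_congr_ae (h2.mono fun x hx => ?_)
        simp only [hx, ← ofReal_norm, norm_gradient]
      rw [e, ← ofReal_norm, ← ENNReal.ofReal_pow (norm_nonneg _)]
      refine ENNReal.ofReal_le_ofReal (pow_le_pow_left₀ (norm_nonneg _) ?_ 2)
      have := norm_le_norm_add_norm_sub' w.2 (wgrad (f n))
      have h3 := hw.2.2
      rw [dist_eq_norm, norm_sub_rev] at h3
      linarith [hM' n, norm_sub_rev w.2 (wgrad (f n))]
  have hcomp : IsCompact (closure (boundedTest O (M + 1))) :=
    (totallyBounded_boundedTest hO hb _).closure.isCompact_of_isClosed isClosed_closure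
  obtain ⟨g, -, k, hk, hg⟩ := hcomp.tendsto_subseq hmem
  exact ⟨g, k, hk, hg⟩

/-! ### Regularity at almost every time -/

/-- Lower semicontinuity of the `L^q` norm with respect to convergence in `L²(O)`. -/
lemma isClosed_eLpNorm_le (O : Set (Rd d)) (q c : ℝ≥0∞) :
    IsClosed {f : L2 O | eLpNorm f q (leb O) ≤ c} := by
  refine IsSeqClosed.isClosed fun f g hf hg => ?_
  obtain ⟨k, -, hk⟩ := (tendstoInMeasure_of_tendsto_Lp hg).exists_seq_tendsto_ae
  refine (Lp.eLpNorm_lim_le_liminf_eLpNorm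
    (fun n => Lp.aestronglyMeasurable (f (k n))) _ hk).trans ?_
  exact liminf_le_of_frequently_le' (Frequently.of_forall fun n => hf (k n))

lemma measurable_eLpNorm_comp {U : ℝ → L2 O} (hU : Continuous U) (q : ℝ≥0∞) :
    Measurable fun t => eLpNorm (U t) q (leb O) := by
  refine measurable_of_Iic fun c => ?_
  have h : IsClosed (U ⁻¹' {f : L2 O | eLpNorm f q (leb O) ≤ c}) :=
    (isClosed_eLpNorm_le O q c).preimage hU
  exact h.measurableSet

lemma norm_le_of_normV (hp : 2 ≤ p) [IsFiniteMeasure (leb O)] (f : L2 O) :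
    ‖f‖ₑ ≤ normV p f * leb O univ ^ (1 / (2 : ℝ≥0∞).toReal - 1 / (ENNReal.ofReal p).toReal) := by
  have h2 : (2 : ℝ≥0∞) ≤ ENNReal.ofReal p := by
    simpa using ENNReal.ofReal_le_ofReal hp
  rw [Lp.enorm_def]
  refine (eLpNorm_le_eLpNorm_mul_rpow_measure_univ h2 (Lp.aestronglyMeasurable f)).trans ?_
  gcongr
  exact le_max_left _ _

lemma IsStrongSolution.continuousOn {T : ℝ} {u₀ : L2 O} {u : ℝ → L2 O} (hp : 2 ≤ p)
    [IsFiniteMeasure (leb O)] (hu : IsStrongSolution O p T u₀ u) : ContinuousOn u (Icc 0 T) := by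
  intro s hs
  rw [ContinuousWithinAt, tendsto_iff_edist_tendsto_0]
  have hC : leb O univ ^ (1 / (2 : ℝ≥0∞).toReal - 1 / (ENNReal.ofReal p).toReal) ≠ ⊤ := by
    refine ENNReal.rpow_ne_top_of_nonneg ?_ (measure_ne_top _ _)
    rw [ENNReal.toReal_ofReal (by linarith), ENNReal.toReal_ofNat, sub_nonneg]
    exact one_div_le_one_div_of_le two_pos hp
  have h := ENNReal.Tendsto.mul_const (hu.cont s hs) (Or.inr hC)
  rw [zero_mul] at h
  refine tendsto_of_tendsto_of_tendsto_of_le_of_le tendsto_const_nhds h (fun _ => zero_le)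
    fun t => ?_
  simp only [edist_eq_enorm_sub]
  exact norm_le_of_normV hp _

lemma memLp_powFun (hp : 2 ≤ p) {f : L2 O} {q : ℝ} (hf : MemLp f (ENNReal.ofReal q) (leb O)) :
    MemLp (powFun p f) (ENNReal.ofReal (q / (p - 1))) (leb O) := by
  have h1 := hf.norm_rpow_div (ENNReal.ofReal (p - 1))
  rw [← ENNReal.ofReal_div_of_pos (by linarith), ENNReal.toReal_ofReal (by linarith)] at h1
  have hm : Measurable fun a : ℝ => |a| ^ (p - 2) * a := by fun_prop
  refine h1.of_le
    (hm.comp_aemeasurable (Lp.aestronglyMeasurable f).aemeasurable).aestronglyMeasurable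
    (Eventually.of_forall fun x => le_of_eq ?_)
  rw [powFun, norm_mul]
  simp only [Real.norm_eq_abs]
  rw [abs_of_nonneg (Real.rpow_nonneg (abs_nonneg _) _),
    abs_of_nonneg (Real.rpow_nonneg (abs_nonneg _) _), abs_rpow_sub_two_mul_abs hp]

/-- The finiteness of the `L^{2p-2}` norm at almost every time follows from that of its time
integral because the norm is a measurable function of time, being lower semicontinuous. -/
lemma ae_memLp_powFun (hp : 2 ≤ p) [IsFiniteMeasure (leb O)] {T : ℝ} {u₀ : L2 O} {u : ℝ → L2 O}
    (hT : 0 < T) (hu : IsStrongSolution O p T u₀ u) :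
    ∀ᵐ t ∂(volume.restrict (Ioo 0 T)), MemLp (powFun p (u t)) 2 (leb O) := by
  obtain ⟨U, hU, heq⟩ : ∃ U : ℝ → L2 O, Continuous U ∧ ∀ t ∈ Ioo 0 T, U t = u t :=
    ⟨IccExtend hT.le ((Icc 0 T).domRestrict u), ((hu.continuousOn hp).domRestrict).Icc_extend',
      fun t ht => IccExtend_of_mem _ _ (Ioo_subset_Icc_self ht)⟩
  have hfin : ∫⁻ t in Ioo 0 T, eLpNorm (U t) (ENNReal.ofReal (2 * p - 2)) (leb O) ^ (2 * p - 2)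
      ≠ ⊤ := by
    refine ne_of_eq_of_ne (setLIntegral_congr_fun measurableSet_Ioo fun t ht => ?_) hu.memLp_pow.ne
    simp only [heq t ht]
  filter_upwards [ae_lt_top ((measurable_eLpNorm_comp hU _).pow_const _) hfin,
    ae_restrict_mem measurableSet_Ioo] with t ht ht'
  rw [heq t ht', ENNReal.rpow_lt_top_iff_of_pos (by linarith)] at ht
  have h2 := memLp_powFun hp ⟨Lp.aestronglyMeasurable (u t), ht⟩
  rwa [show (2 * p - 2) / (p - 1) = 2 by field_simp [show p - 1 ≠ 0 by linarith],
    ENNReal.ofReal_ofNat] at h2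

lemma integral_smul_Ioi_eq_Ioo {E : Type*} [NormedAddCommGroup E] [NormedSpace ℝ E] {T : ℝ}
    {η : ℝ → ℝ} (hη : tsupport η ⊆ Ioo 0 T) (f : ℝ → E) :
    ∫ t in Ioi 0, η t • f t = ∫ t in Ioo 0 T, η t • f t := by
  refine setIntegral_eq_of_subset_of_forall_sdiff_eq_zero measurableSet_Ioi Ioo_subset_Ioi_self
    fun t ht => ?_
  rw [image_eq_zero_of_notMem_tsupport fun h => ht.2 (hη h), zero_smul]

/-- Weak time derivatives are unique. -/
lemma ae_eq_of_hasWeakTimeDeriv {T : ℝ} {u v w : ℝ → L2 O}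
    (hv : HasWeakTimeDeriv (Ioi 0) u v) (hv2 : MemLp v 2 (volume.restrict (Ioi 0)))
    (hw : HasWeakTimeDeriv (Ioo 0 T) u w) (hw2 : MemLp w 2 (volume.restrict (Ioo 0 T))) :
    ∀ᵐ t ∂(volume.restrict (Ioo 0 T)), v t = w t := by
  have hv2' : MemLp v 2 (volume.restrict (Ioo 0 T)) :=
    hv2.mono_measure (Measure.restrict_mono Ioo_subset_Ioi_self le_rfl)
  have hvi : IntegrableOn v (Ioo 0 T) := hv2'.integrable (by norm_num)
  have hwi : IntegrableOn w (Ioo 0 T) := hw2.integrable (by norm_num)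
  have key := isOpen_Ioo.ae_eq_zero_of_integral_contDiff_smul_eq_zero (f := fun t => v t - w t)
    (μ := volume) (U := Ioo 0 T) (hvi.sub hwi).locallyIntegrableOn fun η h1 h2 h3 => by
      have ha := hv η h1 h2 (h3.trans Ioo_subset_Ioi_self)
      have hb := hw η h1 h2 h3
      rw [integral_smul_Ioi_eq_Ioo h3, integral_smul_Ioi_eq_Ioo
        (tsupport_deriv_subset.trans h3), hb, neg_inj] at ha
      obtain ⟨C, hC⟩ := h1.continuous.bounded_above_of_compact_support h2
      have hi {f : ℝ → L2 O} (hf : IntegrableOn f (Ioo 0 T) volume) :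
          IntegrableOn (fun t => η t • f t) (Ioo 0 T) volume :=
        Integrable.bdd_smul hf C h1.continuous.aestronglyMeasurable
          (Eventually.of_forall hC)
      rw [← setIntegral_eq_integral_of_forall_compl_eq_zero (s := Ioo 0 T) fun t ht => by
        rw [image_eq_zero_of_notMem_tsupport fun h => ht (h3 h), zero_smul]]
      simp only [smul_sub]
      rw [integral_sub (hi hvi) (hi hwi), ha, sub_self]
  rw [ae_restrict_iff' measurableSet_Ioo]
  filter_upwards [key] with t ht h
  exact sub_eq_zero.1 (ht h)

/-- At almost every time a strong solution is regular and satisfies the equation pointwise. -/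
lemma ae_isRegular_and_G_eq (hp : 2 ≤ p) [IsFiniteMeasure (leb O)] {u₀ : L2 O} {u : ℝ → L2 O}
    (hu : ∀ T : ℝ, 0 < T → IsStrongSolution O p T u₀ u) {v : ℝ → L2 O}
    (hv : HasWeakTimeDeriv (Ioi 0) u v) (hv2 : MemLp v 2 (volume.restrict (Ioi 0))) :
    ∀ᵐ t ∂(volume.restrict (Ioi 0)), IsRegular p (u t) ∧ G p (u t) = v t := by
  have hT (T : ℝ) (hT : 0 < T) :
      ∀ᵐ t ∂(volume.restrict (Ioo 0 T)), IsRegular p (u t) ∧ G p (u t) = v t := by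
    have h := hu T hT
    obtain ⟨w, hw, hw2, horth⟩ := h.eqn
    have hd := hw2.sub h.memLp_G
    have hz := horth _ hd
    have hint : Integrable (fun t => (inner ℝ (w t - G p (u t)) (w t - G p (u t)) : ℝ))
        (volume.restrict (Ioo 0 T)) := by
      simp only [real_inner_self_eq_norm_sq]
      exact hd.integrable_norm_pow (by norm_num)
    have hz' := (integral_eq_zero_iff_of_nonneg (fun t => real_inner_self_nonneg) hint).1 hz
    filter_upwards [hz', ae_eq_of_hasWeakTimeDeriv hv hv2 hw hw2, ae_memLp_powFun hp hT h,
      h.mem_domA, ae_restrict_mem measurableSet_Ioo] with t h1 h2 h3 h4 h5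
    refine ⟨⟨hasLaplacian_lap h4, (h.mem t (Ioo_subset_Icc_self h5)).1, h3⟩, ?_⟩
    rw [h2]
    exact (sub_eq_zero.1 (inner_self_eq_zero.1 h1)).symm
  have hcov : Ioi (0 : ℝ) = ⋃ n : ℕ, Ioo 0 ((n : ℝ) + 1) := by
    ext t
    simp only [mem_Ioi, mem_iUnion, mem_Ioo]
    refine ⟨fun h => ?_, fun ⟨n, h⟩ => h.1⟩
    obtain ⟨n, hn⟩ := exists_nat_gt t
    exact ⟨n, h, by linarith⟩
  rw [hcov, ae_restrict_iUnion_iff]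
  exact fun n => hT _ (by positivity)

/-! ### Increments in time -/

/-- The smooth transition from `0` to `1` taking place on `[a, a + δ]`. -/
def ramp (a δ : ℝ) (x : ℝ) : ℝ := Real.smoothTransition ((x - a) / δ)

lemma contDiff_ramp (a δ : ℝ) : ContDiff ℝ ∞ (ramp a δ) := by
  unfold ramp
  exact Real.smoothTransition.contDiff.comp ((contDiff_id.sub contDiff_const).div_const δ)

lemma ramp_of_le {a δ x : ℝ} (hδ : 0 < δ) (hx : x ≤ a) : ramp a δ x = 0 :=
  Real.smoothTransition.zero_of_nonpos (div_nonpos_of_nonpos_of_nonneg (by linarith) hδ.le)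

lemma ramp_of_ge {a δ x : ℝ} (hδ : 0 < δ) (hx : a + δ ≤ x) : ramp a δ x = 1 :=
  Real.smoothTransition.one_of_one_le ((one_le_div hδ).2 (by linarith))

lemma deriv_ramp (a δ x : ℝ) :
    deriv (ramp a δ) x = δ⁻¹ * deriv Real.smoothTransition ((x - a) / δ) := by
  have h1 : HasDerivAt (fun x : ℝ => (x - a) / δ) (1 / δ) x :=
    ((hasDerivAt_id x).sub_const a).div_const δ
  have h2 : HasDerivAt Real.smoothTransition (deriv Real.smoothTransition ((x - a) / δ))
      ((x - a) / δ) :=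
    ((Real.smoothTransition.contDiff (n := 1)).differentiable (by simp) _).hasDerivAt
  have h3 := (h2.comp x h1).deriv
  rw [one_div, mul_comm] at h3
  exact h3

lemma continuous_deriv_smoothTransition : Continuous (deriv Real.smoothTransition) :=
  (Real.smoothTransition.contDiff (n := 1)).continuous_deriv (by simp)

lemma deriv_smoothTransition_of_notMem {y : ℝ} (hy : y ∉ Icc (0 : ℝ) 1) :
    deriv Real.smoothTransition y = 0 := by
  rw [mem_Icc, not_and_or, not_le, not_le] at hy
  rcases hy with hy | hy
  · have : Real.smoothTransition =ᶠ[𝓝 y] fun _ => 0 := by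
      filter_upwards [gt_mem_nhds hy] with z hz
      exact Real.smoothTransition.zero_of_nonpos hz.le
    rw [this.deriv_eq, deriv_const]
  · have : Real.smoothTransition =ᶠ[𝓝 y] fun _ => 1 := by
      filter_upwards [lt_mem_nhds hy] with z hz
      exact Real.smoothTransition.one_of_one_le hz.le
    rw [this.deriv_eq, deriv_const]

section Ramp

variable {E : Type*} [NormedAddCommGroup E] [NormedSpace ℝ E]

lemma integral_deriv_ramp_smul {a δ : ℝ} (hδ : 0 < δ) (U : ℝ → E) :
    ∫ x, deriv (ramp a δ) x • U x =
      ∫ y in Icc (0 : ℝ) 1, deriv Real.smoothTransition y • U (a + δ * y) := by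
  rw [setIntegral_eq_integral_of_forall_compl_eq_zero fun y hy => by
    rw [deriv_smoothTransition_of_notMem hy, zero_smul]]
  set F : ℝ → E := fun y => deriv Real.smoothTransition y • U (a + δ * y) with hF
  have h1 : ∫ x, F ((x - a) / δ) = δ • ∫ y, F y := by
    rw [integral_sub_right_eq_self (fun x => F (x / δ)) a, Measure.integral_comp_div, abs_of_pos hδ]
  have h2 (x : ℝ) : deriv (ramp a δ) x • U x = δ⁻¹ • F ((x - a) / δ) := by
    rw [deriv_ramp, hF, mul_smul]
    congr 3
    field_simp
    ring
  simp_rw [h2]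
  rw [integral_smul, h1, smul_smul, inv_mul_cancel₀ hδ.ne', one_smul]

/-- The derivatives of `ramp a δ` converge to the Dirac mass at `a` as `δ → 0`. -/
lemma tendsto_integral_deriv_ramp_smul [CompleteSpace E] (a : ℝ) {U : ℝ → E} (hU : Continuous U) :
    Tendsto (fun δ => ∫ x, deriv (ramp a δ) x • U x) (𝓝[>] 0) (𝓝 (U a)) := by
  have hcont : Continuous fun δ : ℝ =>
      ∫ y in Icc (0 : ℝ) 1, deriv Real.smoothTransition y • U (a + δ * y) := by
    refine continuous_parametric_integral_of_continuous ?_ isCompact_Icc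
    have := continuous_deriv_smoothTransition
    simp only [Function.uncurry_def]
    fun_prop
  have h0 : ∫ y in Icc (0 : ℝ) 1, deriv Real.smoothTransition y • U (a + 0 * y) = U a := by
    simp only [zero_mul, add_zero]
    rw [integral_smul_const, integral_Icc_eq_integral_Ioc,
      ← intervalIntegral.integral_of_le zero_le_one, intervalIntegral.integral_deriv_eq_sub
        (fun x _ => (Real.smoothTransition.contDiff (n := 1)).differentiable (by simp) _)
        (continuous_deriv_smoothTransition.intervalIntegrable _ _)]
    simp
  refine Tendsto.congr' ?_ ((hcont.tendsto' 0 _ h0).mono_left nhdsWithin_le_nhds)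
  filter_upwards [self_mem_nhdsWithin] with δ hδ
  exact (integral_deriv_ramp_smul hδ U).symm

end Ramp

lemma integrable_deriv_ramp_smul {E : Type*} [NormedAddCommGroup E] [NormedSpace ℝ E]
    {a δ : ℝ} (hδ : 0 < δ) {U : ℝ → E} (hU : Continuous U) :
    Integrable fun x => deriv (ramp a δ) x • U x := by
  have hc : Continuous (deriv (ramp a δ)) := (contDiff_ramp a δ).continuous_deriv (by simp)
  refine (hc.smul hU).integrable_of_hasCompactSupport (HasCompactSupport.smul_right ?_)
  refine HasCompactSupport.intro (isCompact_Icc (a := a) (b := a + δ)) fun x hx => ?_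
  rw [deriv_ramp, deriv_smoothTransition_of_notMem, mul_zero]
  contrapose! hx
  rw [mem_Icc, le_div_iff₀ hδ, div_le_iff₀ hδ] at hx
  exact ⟨by linarith, by linarith⟩

lemma intervalIntegrable_norm {v : ℝ → L2 O} (hv2 : MemLp v 2 (volume.restrict (Ioi 0))) {s t : ℝ}
    (hs : 0 ≤ s) (hst : s ≤ t) : IntervalIntegrable (fun x => ‖v x‖) volume s t := by
  rw [intervalIntegrable_iff_integrableOn_Ioc_of_le hst]
  have : MemLp v 2 (volume.restrict (Ioc s t)) :=
    hv2.mono_measure (Measure.restrict_mono (fun x hx => hs.trans_lt hx.1) le_rfl)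
  exact (this.integrable (by norm_num)).norm

lemma integrableOn_norm_sq {v : ℝ → L2 O} (hv2 : MemLp v 2 (volume.restrict (Ioi 0))) :
    IntegrableOn (fun x => ‖v x‖ ^ 2) (Ioi 0) := hv2.integrable_norm_pow (by norm_num)

lemma intervalIntegrable_norm_sq {v : ℝ → L2 O} (hv2 : MemLp v 2 (volume.restrict (Ioi 0)))
    {s t : ℝ} (hs : 0 ≤ s) (hst : s ≤ t) :
    IntervalIntegrable (fun x => ‖v x‖ ^ 2) volume s t := by
  rw [intervalIntegrable_iff_integrableOn_Ioc_of_le hst]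
  exact (integrableOn_norm_sq hv2).mono_set fun x hx => hs.trans_lt hx.1

/-- The definition of the weak derivative is tested with the difference of two ramps, which is
close to the indicator function of `[s, t]`. -/
lemma norm_sub_le_integral {u v : ℝ → L2 O} (hu : ContinuousOn u (Ici 0))
    (hv : HasWeakTimeDeriv (Ioi 0) u v) (hv2 : MemLp v 2 (volume.restrict (Ioi 0)))
    {s t : ℝ} (hs : 0 < s) (hst : s ≤ t) : ‖u t - u s‖ ≤ ∫ x in s..t, ‖v x‖ := by
  set U : ℝ → L2 O := fun x => u (max x 0) with hUdef
  have hU : Continuous U :=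
    hu.comp_continuous (continuous_id.max continuous_const) fun x =>
      mem_Ici.2 (le_max_right _ _)
  have hUu {x : ℝ} (hx : 0 < x) : U x = u x := by rw [hUdef]; simp only [max_eq_left hx.le]
  have hbound : ∀ᶠ δ in 𝓝[>] (0 : ℝ), ‖(∫ x, deriv (ramp s δ) x • U x) -
      ∫ x, deriv (ramp t δ) x • U x‖ ≤ ∫ x in s..(t + δ), ‖v x‖ := by
    filter_upwards [self_mem_nhdsWithin] with δ hδ
    have hδ' : (0 : ℝ) < δ := hδ
    set η : ℝ → ℝ := fun x => ramp s δ x - ramp t δ x with hη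
    have hη0 (x : ℝ) (hx : x ∉ Ioc s (t + δ)) : η x = 0 := by
      rw [mem_Ioc, not_and_or, not_lt, not_le] at hx
      rcases hx with hx | hx
      · simp only [hη, ramp_of_le hδ' hx, ramp_of_le hδ' (hx.trans hst), sub_self]
      · simp only [hη, ramp_of_ge hδ' hx.le, ramp_of_ge hδ' (show s + δ ≤ x by linarith), sub_self]
    have hη1 (x : ℝ) : ‖η x‖ ≤ 1 := by
      rw [Real.norm_eq_abs, abs_le]
      have h1 := Real.smoothTransition.nonneg ((x - s) / δ)
      have h2 := Real.smoothTransition.nonneg ((x - t) / δ)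
      have h3 := Real.smoothTransition.le_one ((x - s) / δ)
      have h4 := Real.smoothTransition.le_one ((x - t) / δ)
      simp only [hη, ramp]
      constructor <;> linarith
    have hts : tsupport η ⊆ Icc s (t + δ) := by
      refine closure_minimal (fun x hx => ?_) isClosed_Icc
      by_contra h
      exact hx (hη0 x fun h' => h (Ioc_subset_Icc_self h'))
    have hts' : tsupport η ⊆ Ioi 0 := hts.trans fun x hx => hs.trans_le hx.1
    have hηc : HasCompactSupport η := isCompact_Icc.of_isClosed_subset (isClosed_tsupport η) hts
    have hw := hv η ((contDiff_ramp s δ).sub (contDiff_ramp t δ)) hηc hts'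
    have e1 : ∫ x in Ioi 0, deriv η x • u x = (∫ x, deriv (ramp s δ) x • U x) -
        ∫ x, deriv (ramp t δ) x • U x := by
      rw [← integral_sub (integrable_deriv_ramp_smul hδ' hU) (integrable_deriv_ramp_smul hδ' hU)]
      have hd (x : ℝ) : deriv (ramp s δ) x • U x - deriv (ramp t δ) x • U x = deriv η x • U x := by
        rw [hη, deriv_fun_sub ((contDiff_ramp s δ).differentiable (by simp) x)
          ((contDiff_ramp t δ).differentiable (by simp) x), sub_smul]
      simp_rw [hd]
      have e2 : ∫ x in Ioi 0, deriv η x • U x = ∫ x, deriv η x • U x :=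
        setIntegral_eq_integral_of_forall_compl_eq_zero fun x hx => by
          rw [image_eq_zero_of_notMem_tsupport fun h => hx (hts' (tsupport_deriv_subset h)),
            zero_smul]
      rw [← e2]
      exact setIntegral_congr_fun measurableSet_Ioi fun x hx => by simp only [hUu hx]
    rw [← e1, hw, norm_neg, intervalIntegral.integral_of_le (by linarith)]
    rw [setIntegral_eq_of_subset_of_forall_sdiff_eq_zero (s := Ioc s (t + δ)) measurableSet_Ioi
      (fun x hx => hs.trans hx.1) fun x hx => by rw [hη0 x hx.2, zero_smul]]
    refine norm_integral_le_of_norm_le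
      (intervalIntegrable_norm hv2 hs.le (show s ≤ t + δ by linarith)).1
      (Eventually.of_forall fun x => ?_)
    rw [norm_smul]
    exact mul_le_of_le_one_left (norm_nonneg _) (hη1 x)
  have hl := ((tendsto_integral_deriv_ramp_smul s hU).sub
    (tendsto_integral_deriv_ramp_smul t hU)).norm
  have hr : Tendsto (fun δ => ∫ x in s..(t + δ), ‖v x‖) (𝓝[>] 0) (𝓝 (∫ x in s..t, ‖v x‖)) := by
    have hc := intervalIntegral.continuousOn_primitive_interval'
      (intervalIntegrable_norm hv2 hs.le (show s ≤ t + 1 by linarith)) left_mem_uIcc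
    rw [uIcc_of_le (by linarith)] at hc
    refine (hc t ⟨hst, by linarith⟩).tendsto.comp (tendsto_nhdsWithin_iff.2 ⟨?_, ?_⟩)
    · have : Continuous fun δ : ℝ => t + δ := by fun_prop
      exact (this.tendsto' 0 t (by simp)).mono_left nhdsWithin_le_nhds
    · filter_upwards [Ioo_mem_nhdsGT (zero_lt_one (α := ℝ))] with δ hδ
      exact ⟨by linarith [hδ.1], by linarith [hδ.2]⟩
  have := le_of_tendsto_of_tendsto hl hr hbound
  rwa [hUu hs, hUu (hs.trans_le hst), norm_sub_rev] at this

lemma norm_sub_sq_le_integral {u v : ℝ → L2 O} (hu : ContinuousOn u (Ici 0))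
    (hv : HasWeakTimeDeriv (Ioi 0) u v) (hv2 : MemLp v 2 (volume.restrict (Ioi 0)))
    {s t : ℝ} (hs : 0 < s) (hst : s ≤ t) :
    ‖u t - u s‖ ^ 2 ≤ (t - s) * ∫ x in s..t, ‖v x‖ ^ 2 := by
  have h1 := norm_sub_le_integral hu hv hv2 hs hst
  have i1 := intervalIntegrable_norm hv2 hs.le hst
  have i2 := intervalIntegrable_norm_sq hv2 hs.le hst
  rcases hst.eq_or_lt with rfl | hlt
  · simp
  set I := ∫ x in s..t, ‖v x‖
  set Q := ∫ x in s..t, ‖v x‖ ^ 2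
  -- the integral of `(‖v‖ - m)²` is nonnegative for the mean value `m` of `‖v‖`
  have h2 : 0 ≤ ∫ x in s..t, (‖v x‖ - I / (t - s)) ^ 2 :=
    intervalIntegral.integral_nonneg hst fun x _ => sq_nonneg _
  have e : ∫ x in s..t, (‖v x‖ - I / (t - s)) ^ 2 =
      Q - 2 * (I / (t - s)) * I + (I / (t - s)) ^ 2 * (t - s) := by
    have : ∀ x, (‖v x‖ - I / (t - s)) ^ 2 =
        ‖v x‖ ^ 2 - 2 * (I / (t - s)) * ‖v x‖ + (I / (t - s)) ^ 2 := fun x => by ring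
    simp_rw [this]
    rw [intervalIntegral.integral_add (i2.sub (i1.const_mul _)) (by simp),
      intervalIntegral.integral_sub i2 (i1.const_mul _), intervalIntegral.integral_const_mul,
      intervalIntegral.integral_const, smul_eq_mul, mul_comm (t - s)]
  have hts : 0 < t - s := sub_pos.2 hlt
  have h3 : I ^ 2 ≤ (t - s) * Q := by
    rw [e] at h2
    have : (t - s) * (Q - 2 * (I / (t - s)) * I + (I / (t - s)) ^ 2 * (t - s)) =
        (t - s) * Q - I ^ 2 := by
      field_simp
      ring
    have := mul_nonneg hts.le h2
    linarith
  exact (pow_le_pow_left₀ (norm_nonneg _) h1 2).trans h3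

/-! ### Bounded energy along a sequence of times -/

/-- On the unit sphere, the subgradient inequality controls the growth of the energy by the
residual `G(f)` and the square of the increment. -/
lemma energy_sub_energy_le_of_sphere (hO : IsOpen O) (hp : 2 ≤ p) {f g : L2 O}
    (hf : IsRegular p f) (hg : MemV p g) (hf1 : ‖f‖ = 1) (hg1 : ‖g‖ = 1) :
    energy p f - energy p g ≤ S p f * (‖f - g‖ ^ 2 / 2) + ‖G p f‖ * ‖f - g‖ := by
  have h1 := energy_sub_energy_le hO hp hf hg
  have e : powL2 p f - lap f = S p f • f - G p f := by rw [G]; abel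
  have h2 : (inner ℝ f (f - g) : ℝ) = ‖f - g‖ ^ 2 / 2 := by
    have := norm_sub_sq_real f g
    rw [inner_sub_right, real_inner_self_eq_norm_sq, this, hf1, hg1]
    ring
  rw [e, inner_sub_left, real_inner_smul_left, h2] at h1
  have h3 := neg_le_of_abs_le (abs_real_inner_le_norm (G p f) (f - g))
  linarith

/-- A discrete Grönwall lemma with summable coefficients. -/
lemma exists_bound_of_step {φ b : ℕ → ℝ} {c : ℝ} (hc : 0 ≤ c) (hφ : ∀ n, 0 ≤ φ n)
    (hb0 : ∀ n, 0 ≤ b n) (hb : Summable b)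
    (h : ∀ n, φ (n + 1) * (1 - c * b n) ≤ φ n + 2 * b n) :
    ∃ C N, ∀ n, φ (N + n) ≤ C := by
  have hsmall : ∀ᶠ n in atTop, c * b n < 1 / 2 := by
    have := hb.tendsto_atTop_zero.const_mul c
    rw [mul_zero] at this
    exact this.eventually (gt_mem_nhds (by norm_num))
  obtain ⟨N, hN⟩ := eventually_atTop.1 hsmall
  have hstep (n : ℕ) (hn : N ≤ n) :
      φ (n + 1) + 1 ≤ (φ n + 1) * Real.exp ((2 * c + 4) * b n) := by
    have hx := hN n hn
    have hx0 : 0 ≤ c * b n := mul_nonneg hc (hb0 n)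
    -- `1 / (1 - x) ≤ 1 + 2x` for `0 ≤ x ≤ 1/2`
    have h1 : φ (n + 1) ≤ (φ n + 2 * b n) * (1 + 2 * (c * b n)) := by
      have h2 := mul_le_mul_of_nonneg_right (h n) (show 0 ≤ 1 + 2 * (c * b n) by linarith)
      have h3 : 0 ≤ φ (n + 1) * ((c * b n) * (1 - 2 * (c * b n))) :=
        mul_nonneg (hφ _) (mul_nonneg hx0 (by linarith))
      linarith
    have h4 : φ (n + 1) + 1 ≤ (φ n + 1) * ((2 * c + 4) * b n + 1) := by
      have h5 : b n * (c * b n) ≤ b n * (1 / 2) := mul_le_mul_of_nonneg_left hx.le (hb0 n)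
      nlinarith [mul_nonneg (hφ n) (hb0 n), hb0 n, hx0]
    exact h4.trans (mul_le_mul_of_nonneg_left (Real.add_one_le_exp _) (by linarith [hφ n]))
  have hind (n : ℕ) : φ (N + n) + 1 ≤
      (φ N + 1) * Real.exp ((2 * c + 4) * ∑ i ∈ Finset.range n, b (N + i)) := by
    induction n with
    | zero => simp
    | succ n ih =>
      rw [Finset.sum_range_succ, mul_add, Real.exp_add, ← mul_assoc]
      exact (hstep (N + n) (by omega)).trans
        (mul_le_mul_of_nonneg_right ih (Real.exp_pos _).le)
  have hbN : Summable fun i => b (N + i) := hb.comp_injective (add_right_injective N)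
  refine ⟨(φ N + 1) * Real.exp ((2 * c + 4) * ∑' i, b (N + i)), N, fun n => ?_⟩
  have h6 : (φ N + 1) * Real.exp ((2 * c + 4) * ∑ i ∈ Finset.range n, b (N + i)) ≤
      (φ N + 1) * Real.exp ((2 * c + 4) * ∑' i, b (N + i)) := by
    refine mul_le_mul_of_nonneg_left (Real.exp_le_exp.2 ?_) (by linarith [hφ N])
    exact mul_le_mul_of_nonneg_left (hbN.sum_le_tsum _ fun i _ => hb0 _) (by linarith)
  linarith [hind n]

/-- There are times tending to infinity along which the energy is bounded and the residual tends
to zero. They are chosen one in each unit interval `(n, n + 1]`, so that `‖∂ₜu‖²` is there at most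
its integral over the interval; the subgradient inequality and the discrete Grönwall lemma then
bound the energy at these times. -/
lemma exists_times (hO : IsOpen O) (hp : 2 ≤ p) [IsFiniteMeasure (leb O)] {u₀ : L2 O}
    {u : ℝ → L2 O} (hu : ∀ T : ℝ, 0 < T → IsStrongSolution O p T u₀ u) {v : ℝ → L2 O}
    (hv : HasWeakTimeDeriv (Ioi 0) u v) (hv2 : MemLp v 2 (volume.restrict (Ioi 0))) :
    ∃ (τ : ℕ → ℝ) (C : ℝ), (∀ n, 0 ≤ τ n) ∧ Tendsto τ atTop atTop ∧
      (∀ n, IsRegular p (u (τ n))) ∧ (∀ n, ‖u (τ n)‖ = 1) ∧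
      Tendsto (fun n => ‖G p (u (τ n))‖) atTop (𝓝 0) ∧ ∀ n, energy p (u (τ n)) ≤ C := by
  have hcont : ContinuousOn u (Ici 0) := by
    intro s hs
    have hs' : s ∈ Icc (0 : ℝ) (s + 1) := ⟨hs, by linarith⟩
    have h1 := (hu (s + 1) (by linarith [mem_Ici.1 hs])).continuousOn hp s hs'
    refine h1.mono_of_mem_nhdsWithin ?_
    filter_upwards [self_mem_nhdsWithin,
      nhdsWithin_le_nhds (gt_mem_nhds (lt_add_one s))] with x h2 h3
    exact ⟨h2, h3.le⟩
  have hsph {t : ℝ} (ht : 0 < t) : MemV p (u t) ∧ ‖u t‖ = 1 := (hu t ht).mem t ⟨ht.le, le_rfl⟩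
  set a : ℕ → ℝ := fun n => ∫ x in (n : ℝ)..(n + 1), ‖v x‖ ^ 2 with ha
  have ha0 (n : ℕ) : 0 ≤ a n :=
    intervalIntegral.integral_nonneg (by linarith) fun x _ => sq_nonneg _
  have hasum : Summable a := by
    refine summable_of_sum_range_le (c := ∫ x in Ioi 0, ‖v x‖ ^ 2) ha0 fun n => ?_
    have := intervalIntegral.sum_integral_adjacent_intervals (f := fun x => ‖v x‖ ^ 2)
      (μ := volume) (a := fun k : ℕ => (k : ℝ)) (n := n) fun k _ =>
        intervalIntegrable_norm_sq hv2 (by positivity) (by simp)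
    simp only [Nat.cast_add, Nat.cast_one, Nat.cast_zero] at this
    rw [this, intervalIntegral.integral_of_le (by positivity)]
    exact setIntegral_mono_set (integrableOn_norm_sq hv2)
      (Eventually.of_forall fun x => sq_nonneg _) (Eventually.of_forall fun x hx => hx.1)
  have hex (n : ℕ) : ∃ t, (t ∈ Ioc (n : ℝ) (n + 1) ∧ IsRegular p (u t) ∧ G p (u t) = v t) ∧
      ‖v t‖ ^ 2 ≤ a n := by
    have hsub : Ioc (n : ℝ) (n + 1) ⊆ Ioi 0 := fun x hx => (Nat.cast_nonneg n).trans_lt hx.1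
    have hae : ∀ᵐ t ∂(volume.restrict (Ioc (n : ℝ) (n + 1))),
        t ∈ Ioc (n : ℝ) (n + 1) ∧ IsRegular p (u t) ∧ G p (u t) = v t :=
      (ae_restrict_mem measurableSet_Ioc).and
        (ae_mono (Measure.restrict_mono hsub le_rfl) (ae_isRegular_and_G_eq hp hu hv hv2))
    have hvol : volume (Ioc (n : ℝ) (n + 1)) = 1 := by simp
    obtain ⟨t, ht, hle⟩ := exists_notMem_null_le_average
      (μ := volume.restrict (Ioc (n : ℝ) (n + 1))) (by simp [Measure.restrict_eq_zero])
      ((integrableOn_norm_sq hv2).mono_set hsub) (ae_iff.1 hae)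
    refine ⟨t, not_not.1 ht, hle.trans_eq ?_⟩
    rw [setAverage_eq, Measure.real, hvol]
    simp [ha, intervalIntegral.integral_of_le (show (n : ℝ) ≤ n + 1 by linarith)]
  choose τ hτ hτa using hex
  have hτ0 (n : ℕ) : 0 < τ n := (Nat.cast_nonneg n).trans_lt (hτ n).1.1
  have hstep (n : ℕ) : energy p (u (τ (n + 1))) * (1 - p * (a n + a (n + 1))) ≤
      energy p (u (τ n)) + 2 * (a n + a (n + 1)) := by
    have h1 := energy_sub_energy_le_of_sphere hO hp (hτ (n + 1)).2.1 (hτ n).2.1.memV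
      (hsph (hτ0 _)).2 (hsph (hτ0 n)).2
    have l1 := (hτ n).1
    have l2 := (hτ (n + 1)).1
    push_cast at l2
    have hle : τ n ≤ τ (n + 1) := l1.2.trans l2.1.le
    have h2 := norm_sub_sq_le_integral hcont hv hv2 (hτ0 n) hle
    have h3 : ∫ x in (τ n)..(τ (n + 1)), ‖v x‖ ^ 2 ≤ a n + a (n + 1) := by
      have e : a n + a (n + 1) = ∫ x in (n : ℝ)..(n + 1 + 1), ‖v x‖ ^ 2 := by
        simp only [ha, Nat.cast_add, Nat.cast_one]
        exact intervalIntegral.integral_add_adjacent_intervals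
          (intervalIntegrable_norm_sq hv2 (by positivity) (by linarith))
          (intervalIntegrable_norm_sq hv2 (by positivity) (by linarith))
      rw [e]
      exact intervalIntegral.integral_mono_interval l1.1.le hle l2.2
        (Eventually.of_forall fun x => sq_nonneg _)
        (intervalIntegrable_norm_sq hv2 (by positivity) (by linarith))
    set D := ‖u (τ (n + 1)) - u (τ n)‖
    set b := a n + a (n + 1) with hb
    have h4 : D ^ 2 ≤ 2 * b := h2.trans (mul_le_mul (by linarith [l1.1, l2.2]) h3
      (intervalIntegral.integral_nonneg hle fun x _ => sq_nonneg _) zero_le_two)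
    have h5 := hτa (n + 1)
    rw [(hτ (n + 1)).2.2] at h1
    have h6 : S p (u (τ (n + 1))) * (D ^ 2 / 2) ≤ p * energy p (u (τ (n + 1))) * b :=
      mul_le_mul (S_le_mul_energy hp _) (by linarith) (by positivity)
        (mul_nonneg (by linarith) (energy_nonneg hp _))
    have h7 : ‖v (τ (n + 1))‖ * D ≤ 2 * b := by
      nlinarith [sq_nonneg (‖v (τ (n + 1))‖ - D), ha0 n, ha0 (n + 1)]
    linarith
  obtain ⟨C, N, hC⟩ := exists_bound_of_step (c := p) (φ := fun n => energy p (u (τ n)))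
    (b := fun n => a n + a (n + 1)) (by linarith) (fun n => energy_nonneg hp _)
    (fun n => add_nonneg (ha0 _) (ha0 _)) (hasum.add ((summable_nat_add_iff 1).2 hasum)) hstep
  have hshift : Tendsto (fun n => N + n) atTop atTop := tendsto_add_atTop_iff_nat N |>.1 (by
    simpa [add_comm, add_left_comm] using tendsto_add_atTop_nat (N + N))
  refine ⟨fun n => τ (N + n), C, fun n => (hτ0 _).le, ?_, fun n => (hτ _).2.1,
    fun n => (hsph (hτ0 _)).2, ?_, hC⟩
  · exact (tendsto_atTop_mono (fun n => (hτ n).1.1.le) tendsto_natCast_atTop_atTop).comp hshift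
  · have h1 : Tendsto (fun n => ‖G p (u (τ n))‖) atTop (𝓝 0) := by
      have h2 : Tendsto (fun n => √(a n)) atTop (𝓝 0) := by
        simpa using hasum.tendsto_atTop_zero.sqrt
      refine squeeze_zero (fun n => norm_nonneg _) (fun n => ?_) h2
      rw [(hτ n).2.2]
      exact Real.le_sqrt_of_sq_le (hτa n)
    exact h1.comp hshift

/-! ### Strong convergence -/

lemma powL2_sub_lap (f : L2 O) : powL2 p f - lap f = S p f • f - G p f := by
  rw [G]; abel

lemma norm_wgrad_le (hp : 2 ≤ p) {f : L2 O} {C : ℝ} (hf : energy p f ≤ C) :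
    ‖wgrad f‖ ≤ √(2 * C) := by
  refine Real.le_sqrt_of_sq_le ?_
  have : 0 ≤ (∫ x in O, |f x| ^ p) / p :=
    div_nonneg (integral_nonneg fun x => by positivity) (by linarith)
  rw [energy] at hf
  linarith

lemma eLpNorm_eq_integral (hp : 2 ≤ p) {f : L2 O} (hf : MemLp f (ENNReal.ofReal p) (leb O)) :
    eLpNorm f (ENNReal.ofReal p) (leb O) = ENNReal.ofReal ((∫ x in O, |f x| ^ p) ^ p⁻¹) := by
  have h := hf.eLpNorm_eq_integral_rpow_norm (by simp; linarith) (by simp)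
  rw [ENNReal.toReal_ofReal (by linarith)] at h
  exact h

lemma integral_eq_toReal_eLpNorm_rpow (hp : 2 ≤ p) {f : L2 O}
    (hf : MemLp f (ENNReal.ofReal p) (leb O)) :
    ∫ x in O, |f x| ^ p = (eLpNorm f (ENNReal.ofReal p) (leb O)).toReal ^ p := by
  have h0 : 0 ≤ ∫ x in O, |f x| ^ p := integral_nonneg fun x => by positivity
  rw [eLpNorm_eq_integral hp hf, ENNReal.toReal_ofReal (by positivity), ← Real.rpow_mul h0,
    inv_mul_cancel₀ (by linarith), Real.rpow_one]

/-- For regular elements of bounded energy and residual, the `H¹` and `L^p` distances are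
controlled by the `L²` distance. -/
lemma norm_wgrad_sub_add_le_mul_norm (hO : IsOpen O) (hp : 2 ≤ p) {f g : L2 O}
    (hf : IsRegular p f) (hg : IsRegular p g) (hf1 : ‖f‖ = 1) (hg1 : ‖g‖ = 1) {C B : ℝ}
    (hfC : energy p f ≤ C) (hgC : energy p g ≤ C) (hfB : ‖G p f‖ ≤ B) (hgB : ‖G p g‖ ≤ B) :
    ‖wgrad (f - g)‖ ^ 2 + 2 ^ (1 - p) * ∫ x in O, |(f - g : L2 O) x| ^ p ≤
      2 * (p * C + B) * ‖f - g‖ := by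
  refine (norm_wgrad_sub_add_le hO hp hf hg).trans ((real_inner_le_norm _ _).trans ?_)
  refine mul_le_mul_of_nonneg_right ?_ (norm_nonneg _)
  have hle {h : L2 O} (h1 : ‖h‖ = 1) (hC : energy p h ≤ C) (hB : ‖G p h‖ ≤ B) :
      ‖powL2 p h - lap h‖ ≤ p * C + B := by
    rw [powL2_sub_lap]
    refine (norm_sub_le _ _).trans (add_le_add ?_ hB)
    rw [norm_smul, h1, mul_one, Real.norm_eq_abs, abs_of_nonneg (S_nonneg h)]
    exact (S_le_mul_energy hp h).trans (mul_le_mul_of_nonneg_left hC (by linarith))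
  refine (norm_sub_le _ _).trans ?_
  linarith [hle hf1 hfC hfB, hle hg1 hgC hgB]

lemma tendsto_normV_of_tendsto (hO : IsOpen O) (hp : 2 ≤ p) {g : ℕ → L2 O} {f : L2 O}
    (hg : ∀ n, IsRegular p (g n)) (hg1 : ∀ n, ‖g n‖ = 1) {C B : ℝ} (hC : ∀ n, energy p (g n) ≤ C)
    (hB : ∀ n, ‖G p (g n)‖ ≤ B) (hgf : Tendsto g atTop (𝓝 f)) :
    MemV p f ∧ Tendsto (fun n => normV p (g n - f)) atTop (𝓝 0) := by
  have hest (n m : ℕ) := norm_wgrad_sub_add_le_mul_norm hO hp (hg n) (hg m) (hg1 n) (hg1 m)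
    (hC n) (hC m) (hB n) (hB m)
  set K := 2 * (p * C + B)
  have hdist : Tendsto (fun q : ℕ × ℕ => ‖g q.1 - g q.2‖) atTop (𝓝 0) := by
    simpa only [dist_eq_norm] using cauchySeq_iff_tendsto_dist_atTop_0.1 hgf.cauchySeq
  have hpos : (0 : ℝ) < 2 ^ (1 - p) := by positivity
  -- convergence of the gradients
  have hcg : CauchySeq fun n => wgrad (g n) := by
    rw [cauchySeq_iff_tendsto_dist_atTop_0]
    have h1 : Tendsto (fun q : ℕ × ℕ => √(K * ‖g q.1 - g q.2‖)) atTop (𝓝 0) := by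
      simpa using (hdist.const_mul K).sqrt
    refine squeeze_zero (fun _ => dist_nonneg) (fun q => ?_) h1
    rw [dist_eq_norm, ← wgrad_sub hO (hg _).memV.1 (hg _).memV.1]
    refine Real.le_sqrt_of_sq_le (le_trans (le_add_of_nonneg_right ?_) (hest q.1 q.2))
    exact mul_nonneg hpos.le (integral_nonneg fun x => by positivity)
  obtain ⟨w, hw⟩ := cauchySeq_tendsto_of_complete hcg
  have hgraph : (f, w) ∈ H01Graph O :=
    (testGraph O).isClosed_topologicalClosure.mem_of_tendsto (hgf.prodMk_nhds hw)
      (Eventually.of_forall fun n => wgrad_mem_graph (hg n).memV.1)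
  have hfH : f ∈ H01 O := mem_H01_iff.2 ⟨w, hgraph⟩
  -- convergence in `L^p`
  have hLp : Tendsto (fun n => eLpNorm (g n - f : L2 O) (ENNReal.ofReal p) (leb O)) atTop
      (𝓝 0) := by
    rw [ENNReal.tendsto_atTop_zero]
    intro ε hε
    have h1 : Tendsto (fun q : ℕ × ℕ =>
        ENNReal.ofReal (((2 ^ (1 - p))⁻¹ * (K * ‖g q.1 - g q.2‖)) ^ p⁻¹)) atTop (𝓝 0) := by
      have h2 := ((hdist.const_mul K).const_mul (2 ^ (1 - p) : ℝ)⁻¹).rpow_const (p := p⁻¹)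
        (Or.inr (by positivity))
      rw [mul_zero, mul_zero, Real.zero_rpow (inv_ne_zero (by linarith))] at h2
      simpa using ENNReal.tendsto_ofReal h2
    obtain ⟨⟨N, N'⟩, hN⟩ := eventually_atTop.1 (h1.eventually (ge_mem_nhds hε))
    refine ⟨N, fun n hn => ?_⟩
    refine (isClosed_eLpNorm_le O (ENNReal.ofReal p) ε).mem_of_tendsto
      (tendsto_const_nhds.sub hgf) ?_
    filter_upwards [eventually_ge_atTop N'] with m hm
    refine le_trans ?_ (hN (n, m) ⟨hn, hm⟩)
    rw [eLpNorm_eq_integral hp ((hg n).memV.sub (hg m).memV).2]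
    refine ENNReal.ofReal_le_ofReal (Real.rpow_le_rpow
      (integral_nonneg fun x => by positivity) ?_ (by positivity))
    rw [← div_eq_inv_mul, le_div_iff₀ hpos, mul_comm]
    exact le_trans (le_add_of_nonneg_left (sq_nonneg _)) (hest n m)
  have hfV : MemV p f := by
    refine ⟨hfH, ?_⟩
    obtain ⟨n, hn⟩ := (hLp.eventually (gt_mem_nhds ENNReal.zero_lt_top)).exists
    have h1 : MemLp (g n - f : L2 O) (ENNReal.ofReal p) (leb O) :=
      ⟨Lp.aestronglyMeasurable _, hn⟩
    have h2 := (hg n).memV.2.sub h1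
    refine (memLp_congr_ae ?_).1 h2
    filter_upwards [Lp.coeFn_sub (g n) f] with x hx
    rw [Pi.sub_apply, hx, Pi.sub_apply, sub_sub_cancel]
  refine ⟨hfV, ?_⟩
  have hgr : Tendsto (fun n => eLpNorm (wgrad (g n - f)) 2 (leb O)) atTop (𝓝 0) := by
    have h1 (n : ℕ) : eLpNorm (wgrad (g n - f)) 2 (leb O) = edist (wgrad (g n)) w := by
      rw [wgrad_sub hO (hg n).memV.1 hfH, wgrad_eq hO hgraph, ← Lp.enorm_def, edist_eq_enorm_sub]
    simp_rw [h1]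
    exact tendsto_iff_edist_tendsto_0.1 hw
  simpa [normV] using hLp.max hgr

lemma tendsto_wgrad_of_normV (hO : IsOpen O) {g : ℕ → L2 O} {f : L2 O}
    (hg : ∀ n, MemV p (g n)) (hf : MemV p f)
    (h : Tendsto (fun n => normV p (g n - f)) atTop (𝓝 0)) :
    Tendsto (fun n => wgrad (g n)) atTop (𝓝 (wgrad f)) := by
  rw [tendsto_iff_edist_tendsto_0]
  refine tendsto_of_tendsto_of_tendsto_of_le_of_le tendsto_const_nhds h (fun _ => zero_le)
    fun n => ?_
  simp only [edist_eq_enorm_sub]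
  rw [← wgrad_sub hO (hg n).1 hf.1, Lp.enorm_def]
  exact le_max_right _ _

lemma tendsto_integral_of_normV (hp : 2 ≤ p) {g : ℕ → L2 O} {f : L2 O}
    (hg : ∀ n, MemV p (g n)) (hf : MemV p f)
    (h : Tendsto (fun n => normV p (g n - f)) atTop (𝓝 0)) :
    Tendsto (fun n => ∫ x in O, |g n x| ^ p) atTop (𝓝 (∫ x in O, |f x| ^ p)) := by
  have : Fact (1 ≤ ENNReal.ofReal p) := ⟨by simpa using by linarith⟩
  have h1 : Tendsto (fun n => (hg n).2.toLp (g n)) atTop (𝓝 (hf.2.toLp f)) := by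
    rw [Lp.tendsto_Lp_iff_tendsto_eLpNorm'']
    refine tendsto_of_tendsto_of_tendsto_of_le_of_le tendsto_const_nhds h (fun _ => zero_le)
      fun n => ?_
    rw [← eLpNorm_congr_ae (Lp.coeFn_sub (g n) f)]
    exact le_max_left _ _
  have h2 := h1.norm.rpow_const (p := p) (Or.inr (by linarith))
  simp only [Lp.norm_toLp] at h2
  simp_rw [fun n => integral_eq_toReal_eLpNorm_rpow hp (hg n).2]
  rw [integral_eq_toReal_eLpNorm_rpow hp hf.2]
  exact h2

/-! ### The stationary equation -/

lemma abs_powFun_mul_le (hp : 2 ≤ p) (a b ε : ℝ) (hε : |ε| ≤ 1) :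
    |(|a + ε * b| ^ (p - 2) * (a + ε * b)) * b| ≤ (|a| + |b|) ^ p := by
  have h1 : |a + ε * b| ≤ |a| + |b| := by
    refine (abs_add_le _ _).trans ?_
    rw [abs_mul]
    linarith [mul_le_of_le_one_left (abs_nonneg b) hε]
  rw [abs_mul, abs_mul, abs_of_nonneg (Real.rpow_nonneg (abs_nonneg _) _)]
  have h2 : |(|a| + |b|)| = |a| + |b| := abs_of_nonneg (by positivity)
  have h3 := abs_rpow_sub_two_mul_mul_self hp (|a| + |b|)
  rw [h2] at h3
  rw [← h3]
  gcongr
  linarith [abs_nonneg a]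

lemma integrable_add_abs_rpow (hp : 2 ≤ p) {f ψ : L2 O} (hf : MemV p f) (hψ : MemV p ψ) :
    Integrable (fun x => (|f x| + |ψ x|) ^ p) (leb O) := by
  have h := integrable_abs_rpow_of_memLp (p := p) (by linarith) (hf.2.norm.add hψ.2.norm)
  refine h.congr (Eventually.of_forall fun x => ?_)
  simp only [Pi.add_apply, Real.norm_eq_abs]
  rw [abs_of_nonneg (by positivity)]

lemma aestronglyMeasurable_powFun_mul (f ψ : L2 O) (ε : ℝ) :
    AEStronglyMeasurable (fun x => (|f x + ε * ψ x| ^ (p - 2) * (f x + ε * ψ x)) * ψ x)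
      (leb O) := by
  have hm : Measurable fun a : ℝ × ℝ => (|a.1 + ε * a.2| ^ (p - 2) * (a.1 + ε * a.2)) * a.2 := by
    fun_prop
  exact (hm.comp_aemeasurable ((Lp.aestronglyMeasurable f).aemeasurable.prodMk
    (Lp.aestronglyMeasurable ψ).aemeasurable)).aestronglyMeasurable

/-- A constrained minimality property of `f` implies the stationary equation with multiplier `c`.
This is Minty's argument: by convexity, the difference quotients of the energy at `f` in the
direction `ψ` are bounded above by the derivatives at `f + ε ψ`, and `ε → 0`. -/
lemma le_of_energy_sub_energy_le (hO : IsOpen O) (hp : 2 ≤ p) {f : L2 O} (hf : MemV p f) {c : ℝ}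
    (h : ∀ g, MemV p g → energy p f - energy p g ≤ c * inner ℝ f (f - g)) {ψ : L2 O}
    (hψ : MemV p ψ) :
    c * inner ℝ f ψ ≤ inner ℝ (wgrad f) (wgrad ψ) + ∫ x in O, powFun p f x * ψ x := by
  have hp0 : 0 < p := by linarith
  set F : ℝ → Rd d → ℝ := fun ε x => (|f x + ε * ψ x| ^ (p - 2) * (f x + ε * ψ x)) * ψ x with hF
  have hFint {ε : ℝ} (hε : |ε| ≤ 1) : Integrable (F ε) (leb O) :=
    (integrable_add_abs_rpow hp hf hψ).mono' (aestronglyMeasurable_powFun_mul f ψ ε)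
      (Eventually.of_forall fun x => abs_powFun_mul_le hp _ _ _ hε)
  have hle : ∀ᶠ ε in 𝓝[>] (0 : ℝ), c * inner ℝ f ψ ≤
      inner ℝ (wgrad f) (wgrad ψ) + ε * ‖wgrad ψ‖ ^ 2 + ∫ x in O, F ε x := by
    filter_upwards [Ioo_mem_nhdsGT (zero_lt_one (α := ℝ))] with ε hε
    have hε1 : |ε| ≤ 1 := by rw [abs_of_pos hε.1]; exact hε.2.le
    have hg : MemV p (f + ε • ψ) := hf.add (hψ.smul ε)
    have h1 := h _ hg
    rw [sub_add_cancel_left, inner_neg_right, real_inner_smul_right, energy, energy] at h1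
    have h2 : wgrad (f + ε • ψ) = wgrad f + ε • wgrad ψ := by
      rw [wgrad_add hO hf.1 (hψ.smul ε).1, wgrad_smul hO hψ.1]
    have h3 : (∫ x in O, |(f + ε • ψ : L2 O) x| ^ p) / p - (∫ x in O, |f x| ^ p) / p ≤
        ε * ∫ x in O, F ε x := by
      rw [← sub_div, div_le_iff₀ hp0, ← integral_sub (integrable_abs_rpow_of_memLp hp0 hg.2)
        (integrable_abs_rpow_of_memLp hp0 hf.2), ← integral_const_mul, ← integral_mul_const]
      refine integral_mono_ae ((integrable_abs_rpow_of_memLp hp0 hg.2).sub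
        (integrable_abs_rpow_of_memLp hp0 hf.2)) (((hFint hε1).const_mul ε).mul_const p) ?_
      filter_upwards [Lp.coeFn_add f (ε • ψ), Lp.coeFn_smul ε ψ] with x hx1 hx2
      have h4 := abs_rpow_sub_abs_rpow_le hp (f x + ε * ψ x) (f x)
      simp only [hx1, Pi.add_apply, hx2, Pi.smul_apply, smul_eq_mul, hF]
      rw [add_sub_cancel_left] at h4
      linarith
    rw [h2, norm_add_sq_real, real_inner_smul_right, norm_smul, mul_pow, Real.norm_eq_abs,
      sq_abs] at h1
    have h5 : ε * (c * inner ℝ f ψ) ≤ ε * (inner ℝ (wgrad f) (wgrad ψ) + ε * ‖wgrad ψ‖ ^ 2 +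
        ∫ x in O, F ε x) := by
      nlinarith [mul_nonneg (sq_nonneg ε) (sq_nonneg ‖wgrad ψ‖)]
    exact le_of_mul_le_mul_left h5 hε.1
  have hlim : Tendsto (fun ε => ∫ x in O, F ε x) (𝓝[>] 0) (𝓝 (∫ x in O, powFun p f x * ψ x)) := by
    refine tendsto_integral_filter_of_dominated_convergence _
      (Eventually.of_forall fun ε => aestronglyMeasurable_powFun_mul f ψ ε) ?_
      (integrable_add_abs_rpow hp hf hψ) (Eventually.of_forall fun x => ?_)
    · filter_upwards [Ioo_mem_nhdsGT (zero_lt_one (α := ℝ))] with ε hε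
      refine Eventually.of_forall fun x => abs_powFun_mul_le hp _ _ _ ?_
      rw [abs_of_pos hε.1]
      exact hε.2.le
    · have hc : Continuous fun ε => F ε x := by
        have h1 : Continuous fun ε : ℝ => |f x + ε * ψ x| ^ (p - 2) :=
          Continuous.rpow_const (by fun_prop) fun _ => Or.inr (by linarith)
        simp only [hF]
        fun_prop
      exact (hc.tendsto' 0 _ (by simp [hF, powFun])).mono_left nhdsWithin_le_nhds
  have hε0 : Tendsto (fun ε : ℝ => ε * ‖wgrad ψ‖ ^ 2) (𝓝[>] 0) (𝓝 0) := by
    have : Continuous fun ε : ℝ => ε * ‖wgrad ψ‖ ^ 2 := by fun_prop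
    exact (this.tendsto' 0 0 (by simp)).mono_left nhdsWithin_le_nhds
  have hfin := ge_of_tendsto ((hε0.const_add (inner ℝ (wgrad f) (wgrad ψ))).add hlim) hle
  rwa [add_zero] at hfin

lemma solvesStationary_of_energy_sub_energy_le (hO : IsOpen O) (hp : 2 ≤ p) {f : L2 O}
    (hf : MemV p f)
    (h : ∀ g, MemV p g → energy p f - energy p g ≤ S p f * inner ℝ f (f - g)) :
    SolvesStationary p f := by
  refine ⟨hf, memLp_powFun hp hf.2, fun ψ hψ => ?_⟩
  have h1 := le_of_energy_sub_energy_le hO hp hf h hψ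
  have h2 := le_of_energy_sub_energy_le hO hp hf h (hψ.smul (-1))
  have e : ∫ x in O, powFun p f x * ((-1 : ℝ) • ψ : L2 O) x = -∫ x in O, powFun p f x * ψ x := by
    rw [← integral_neg]
    refine integral_congr_ae ?_
    filter_upwards [Lp.coeFn_smul (-1 : ℝ) ψ] with x hx
    rw [hx, Pi.smul_apply, smul_eq_mul]
    ring
  rw [e, wgrad_smul hO hψ.1, real_inner_smul_right, real_inner_smul_right] at h2
  linarith

end ConstrainedHeat

end

open ConstrainedHeat

theorem proposition1p2 (d : ℕ) (hd : 1 ≤ d) (p : ℝ) (hp : 2 ≤ p)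
    (O : Set (Rd d)) (hO : IsOpen O) (hconn : IsConnected O) (hbdd : Bornology.IsBounded O)
    (hC2 : HasC2Boundary O)
    (u₀ : L2 O) (hu₀ : MemV p u₀ ∧ u₀ ∈ unitSphere O)
    (u : ℝ → L2 O) (hu : ∀ T : ℝ, 0 < T → IsStrongSolution O p T u₀ u)
    (hderiv : ∃ v : ℝ → L2 O, HasWeakTimeDeriv (Set.Ioi 0) u v ∧
      MemLp v 2 (volume.restrict (Set.Ioi 0))) :
    ∃ (τ : ℕ → ℝ) (uinf : L2 O),
      (∀ n, 0 ≤ τ n) ∧ Tendsto τ atTop atTop ∧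
      MemV p uinf ∧
      Tendsto (fun n => normV p (u (τ n) - uinf)) atTop (𝓝 0) ∧
      Tendsto (fun n => S p (u (τ n))) atTop (𝓝 (S p uinf)) ∧
      uinf ∈ unitSphere O ∧
      SolvesStationary p uinf := by
  have : IsFiniteMeasure (leb O) := ⟨by simpa using hbdd.measure_lt_top⟩
  obtain ⟨v, hv, hv2⟩ := hderiv
  obtain ⟨τ, C, hτ0, hτ, hreg, hnorm, hG, hC⟩ := exists_times hO hp hu hv hv2
  obtain ⟨f, k, hk, hf⟩ := exists_tendsto_subseq_of_bounded hO hbdd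
    (M := max 1 √(2 * C)) (fun n => (hreg n).memV.1)
    (fun n => (hnorm n).le.trans (le_max_left _ _))
    (fun n => (norm_wgrad_le hp (hC n)).trans (le_max_right _ _))
  obtain ⟨B, hB⟩ := hG.bddAbove_range
  obtain ⟨hfV, hfn⟩ := tendsto_normV_of_tendsto hO hp (fun n => hreg (k n)) (fun n => hnorm (k n))
    (fun n => hC (k n)) (fun n => hB (mem_range_self (k n))) hf
  have hgrad := tendsto_wgrad_of_normV hO (fun n => (hreg (k n)).memV) hfV hfn
  have hint := tendsto_integral_of_normV hp (fun n => (hreg (k n)).memV) hfV hfn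
  have hS : Tendsto (fun n => S p (u (τ (k n)))) atTop (𝓝 (S p f)) := (hgrad.norm.pow 2).add hint
  have hE : Tendsto (fun n => energy p (u (τ (k n)))) atTop (𝓝 (energy p f)) :=
    ((hgrad.norm.pow 2).div_const 2).add (hint.div_const p)
  refine ⟨τ ∘ k, f, fun n => hτ0 _, hτ.comp hk.tendsto_atTop, hfV, hfn, hS, ?_,
    solvesStationary_of_energy_sub_energy_le hO hp hfV fun g hg => ?_⟩
  · exact tendsto_nhds_unique hf.norm (tendsto_const_nhds.congr fun n => (hnorm (k n)).symm)
  · have hG0 : Tendsto (fun n => G p (u (τ (k n)))) atTop (𝓝 0) :=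
      tendsto_zero_iff_norm_tendsto_zero.2 (hG.comp hk.tendsto_atTop)
    have hr := ((hS.smul hf).sub hG0).inner (𝕜 := ℝ) (hf.sub_const g)
    rw [sub_zero, real_inner_smul_left] at hr
    refine le_of_tendsto_of_tendsto' (hE.sub_const _) hr fun n => ?_
    have := energy_sub_energy_le hO hp (hreg (k n)) hg
    rwa [powL2_sub_lap] at this
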